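/- Let $q\in\{2,3,4\}$ and let $X_q$ be the elliptic curve over $\mathbf F_q$ given by $y^2+y=x^3+x+1$ ($q=2$), $y^2=x^3-x-1$ ($q=3$), $y^2+y=x^3+\alpha$ with $\mathbf F_4=\mathbf F_2(\alpha)$ ($q=4$). Let $F$ be its function field, $\infty$ its point at infinity, $A=\mathbf F_q[x,y]$ the ring of functions in $F$ that are regular outside $\infty$, $F_\infty$ the completion of $F$ at $\infty$, $\mathcal O_\infty$ its ring of integers, and $t=x/y$, a uniformizer at $\infty$. Put $G_\infty=\mathrm{GL}_2(F_\infty)$, $K_\infty=\mathrm{GL}_2(\mathcal O_\infty)$, let $Z_\infty$ be the centre of $G_\infty$, $\Gamma=\mathrm{GL}_2(A)$, and write $[a,b]=\begin{pmatrix}a&b\\0&1\end{pmatrix}$. Let $\mathcal T$ be the Bruhat–Tits tree with vertex set $G_\infty/K_\infty Z_\infty$, in which the classes of $g_1,g_2$ are adjacent when $g_1^{-1}g_2$ is equivalent modulo $K_\infty Z_\infty$ to $[t,b]$ for some $b\in\mathcal O_\infty/t$ or to $[t^{-1},0]$. The Hecke operator $\Phi_\infty$ acts on $\mathbf C$-valued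 functions on the vertices by summation over neighbouring vertices. Functions on $\Gamma\backslash\mathcal T$ are the $\Gamma$-invariant functions on the vertices of $\mathcal T$. Such an $f$ is a cusp form if, for all $\gamma\in\mathrm{GL}_2(F)$ and $g\in G_\infty$, $$\int_{F_\infty/\Lambda_\gamma} f(\gamma\,[1,x]\,g)\,dx=0,\qquad \Lambda_\gamma=\{x\in F_\infty:\gamma\,[1,x]\,\gamma^{-1}\in\Gamma\},$$ where $dx$ is a Haar measure. Consider the vertices $c_n=[t^{-n},0]$ ($n\ge 0$), $z_0=[1,t^{-1}]$, $z_1=[t,t^{-1}]$, and the $q$ vertices $t_\ell=[t^2,t^{-1}+\ell t]$ ($\ell\in\mathbf F_q$), also denoted $t_1,\dots,t_q$. There is exactly one $\Phi_\infty$-stable linear space $\mathcal S$ of functions on $\Gamma\backslash\mathcal T$ such that, for some constants $\lambda_n,\mu_n,\nu_n\in\mathbf C$ with $\lambda_0=0$ and $\mu_0=-2$, $\mathcal S$ consists of all $f$ satisfying, for every $n\ge0$, $$f(c_n)=\begin{cases}\lambda_n f(z_0)+\mu_n\,(f(t_1)+\dots+f(t_q)) & n\text{ even},\\ \nu_n f(z_1)&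 n\text{ odd}\end{cases}$$ (in particular $f(c_0)=-2(f(t_1)+\dots+f(t_q))$). The space $\mathcal S$ has a basis of $q+2$ eigenforms of $\Phi_\infty$ such that exactly $q-1$ of them are cusp forms; these have eigenvalue $0$ and are supported on the vertices of $\Gamma\backslash\mathcal T$ represented by $t_1,\dots,t_q$. The other three are not cusp forms and have eigenvalues $0$, $q$ and $-q$ respectively. Moreover, the cusp forms in $\mathcal S$ are exactly the linear combinations of those $q-1$ basis elements. -/

import Mathlib

open scoped WithZero

noncomputable section

namespace EllTree

open WeierstrassCurve.Affine Polynomial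

variable {k : Type*} [Field k]

/-- The three curves: `y² + y = x³ + x + 1` over the field with two elements,
`y² = x³ - x - 1` over the field with three elements, and `y² + y = x³ + α` over the field with
four elements, `α` being a generator of that field over its prime field. -/
def IsCurveX (W : WeierstrassCurve k) : Prop :=
  (Nat.card k = 2 ∧ W = { a₁ := 0, a₂ := 0, a₃ := 1, a₄ := 1, a₆ := 1 }) ∨
  (Nat.card k = 3 ∧ W = { a₁ := 0, a₂ := 0, a₃ := 0, a₄ := -1, a₆ := -1 }) ∨
  (Nat.card k = 4 ∧ ∃ α : k, α ^ 2 + α + 1 = 0 ∧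
    W = { a₁ := 0, a₂ := 0, a₃ := 1, a₄ := 0, a₆ := α })

variable (W : WeierstrassCurve k)

/-- The ring `A = k[x, y]` of functions on the curve that are regular outside `∞`. -/
abbrev A : Type _ := W.toAffine.CoordinateRing

/-- The function field `F` of the curve. -/
abbrev F : Type _ := W.toAffine.FunctionField

/-- The class of `y` in `A`. -/
def yA : A W := CoordinateRing.mk W.toAffine X

/-- The class of `x` in `A`. -/
def xA : A W := algebraMap k[X] (A W) X

open Classical in
/-- The absolute value at `∞` on `A`. The norm of `f ∈ A` to `k[x]` has degree
`-ord_∞ f`, since `∞` is the only place of `F` above the place at infinity of `k(x)`. -/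
def absInf (f : A W) : ℤᵐ⁰ :=
  if f = 0 then 0 else WithZero.exp ((Algebra.norm k[X] f).natDegree : ℤ)

variable {W}

lemma norm_ne_zero {f : A W} (hf : f ≠ 0) : Algebra.norm k[X] f ≠ 0 :=
  haveI : Module.Finite k[X] (A W) := .of_basis (CoordinateRing.basis W.toAffine)
  Algebra.norm_ne_zero_iff.mpr hf

lemma norm_degree_add_le (f g : A W) :
    (Algebra.norm k[X] (f + g)).degree ≤
      max (Algebra.norm k[X] f).degree (Algebra.norm k[X] g).degree := by
  obtain ⟨p, q, rfl⟩ := CoordinateRing.exists_smul_basis_eq f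
  obtain ⟨p', q', rfl⟩ := CoordinateRing.exists_smul_basis_eq g
  have h : (p • (1 : A W) + q • CoordinateRing.mk W.toAffine X) +
      (p' • (1 : A W) + q' • CoordinateRing.mk W.toAffine X) =
      (p + p') • (1 : A W) + (q + q') • CoordinateRing.mk W.toAffine X := by
    simp only [add_smul]; abel
  rw [h, CoordinateRing.degree_norm_smul_basis, CoordinateRing.degree_norm_smul_basis,
    CoordinateRing.degree_norm_smul_basis]
  have key : ∀ a b : k[X], 2 • (a + b).degree ≤ max (2 • a.degree) (2 • b.degree) := by
    intro a b
    rcases le_total a.degree b.degree with hab | hab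
    · refine le_trans ?_ (le_max_right _ _)
      exact nsmul_le_nsmul_right ((degree_add_le a b).trans (by simp [hab])) 2
    · refine le_trans ?_ (le_max_left _ _)
      exact nsmul_le_nsmul_right ((degree_add_le a b).trans (by simp [hab])) 2
  refine max_le ?_ ?_
  · exact (key p p').trans (max_le_max (le_max_left _ _) (le_max_left _ _))
  · refine (add_le_add_left (key q q') 3).trans ?_
    rcases le_total (2 • q.degree) (2 • q'.degree) with hq | hq
    · rw [max_eq_right hq]; exact (le_max_right _ _).trans (le_max_right _ _)
    · rw [max_eq_left hq]; exact (le_max_right _ _).trans (le_max_left _ _)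

variable (W)

/-- The absolute value at `∞` as a valuation on `A`. -/
def valA : Valuation (A W) ℤᵐ⁰ where
  toFun := absInf W
  map_zero' := by simp [absInf]
  map_one' := by simp [absInf]
  map_mul' f g := by
    by_cases hf : f = 0
    · simp [absInf, hf]
    by_cases hg : g = 0
    · simp [absInf, hg]
    simp only [absInf, hf, hg, mul_ne_zero hf hg, if_false, map_mul]
    rw [natDegree_mul (norm_ne_zero hf) (norm_ne_zero hg), Nat.cast_add, WithZero.exp_add]
  map_add_le_max' f g := by
    by_cases hf : f = 0
    · simp [absInf, hf]
    by_cases hg : g = 0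
    · simp [absInf, hg]
    by_cases hfg : f + g = 0
    · simp [absInf, hfg]
    simp only [absInf, hf, hg, hfg, if_false]
    have h := norm_degree_add_le f g
    rw [degree_eq_natDegree (norm_ne_zero hf), degree_eq_natDegree (norm_ne_zero hg),
      degree_eq_natDegree (norm_ne_zero hfg)] at h
    rw [le_max_iff] at h ⊢
    simpa only [WithZero.exp_le_exp, Nat.cast_le] using h

lemma valA_ne_zero {f : A W} (hf : f ≠ 0) : valA W f ≠ 0 := by
  change absInf W f ≠ 0
  simp [absInf, hf]

lemma valA_supp : nonZeroDivisors (A W) ≤ (valA W).supp.primeCompl := by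
  intro f hf hf'
  exact valA_ne_zero W (nonZeroDivisors.ne_zero hf) ((Valuation.mem_supp_iff _ _).mp hf')

/-- The valuation of `F` at the place `∞`, normalized so that a uniformizer has value
`exp (-1)`. -/
def valInf : Valuation (F W) ℤᵐ⁰ := (valA W).extendToLocalization (valA_supp W) (F W)

/-- The completion `F_∞` of `F` at the place `∞`. -/
abbrev Finf : Type _ := (valInf W).Completion

/-- The embedding of `F` into `F_∞`. -/
def toFinf : F W →+* Finf W :=
  UniformSpace.Completion.coeRingHom.comp (WithVal.equiv (valInf W)).symm.toRingHom

/-- The embedding of `A` into `F_∞`. -/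
def AtoFinf : A W →+* Finf W := (toFinf W).comp (algebraMap (A W) (F W))

lemma AtoFinf_ne_zero {f : A W} (hf : f ≠ 0) : AtoFinf W f ≠ 0 := by
  have h : algebraMap (A W) (F W) f ≠ 0 := by simpa using hf
  exact (map_ne_zero (toFinf W)).mpr h

lemma xA_ne_zero : xA W ≠ 0 := by
  have h : (algebraMap k[X] (A W)) X ≠ algebraMap k[X] (A W) 0 :=
    (FaithfulSMul.algebraMap_injective k[X] (A W)).ne X_ne_zero
  simpa [xA] using h

lemma yA_ne_zero : yA W ≠ 0 := by
  have h := CoordinateRing.YClass_ne_zero (W' := W.toAffine) (0 : k[X])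
  simpa [CoordinateRing.YClass, yA] using h

/-- The uniformizer `t = x / y` at `∞`, as a unit of the field `F_∞`. -/
def t : (Finf W)ˣ :=
  Units.mk0 (AtoFinf W (xA W)) (AtoFinf_ne_zero W (xA_ne_zero W)) *
    (Units.mk0 (AtoFinf W (yA W)) (AtoFinf_ne_zero W (yA_ne_zero W)))⁻¹

/-- The group `G_∞ = GL₂(F_∞)`. -/
abbrev Ginf : Type _ := GL (Fin 2) (Finf W)

/-- The matrix with rows `(a, b)` and `(0, 1)`. -/
def psl {R : Type*} [CommRing R] (a : Rˣ) (b : R) : GL (Fin 2) R :=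
  Matrix.GeneralLinearGroup.mk'' !![(a : R), b; 0, 1] (by simp [Matrix.det_fin_two])

/-- The group `Γ = GL₂(A)`, as a subgroup of `G_∞`. -/
def Gam : Subgroup (Ginf W) := (Matrix.GeneralLinearGroup.map (n := Fin 2) (AtoFinf W)).range

/-- The maximal compact subgroup `K_∞ = GL₂(𝒪_∞)` of `G_∞`. -/
def Kinf : Subgroup (Ginf W) :=
  (Matrix.GeneralLinearGroup.map (n := Fin 2) (Valued.integer (Finf W)).subtype).range

/-- The subgroup `K_∞ Z_∞` of `G_∞`, with `Z_∞` the centre of `G_∞`. -/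
def KZ : Subgroup (Ginf W) := Kinf W ⊔ Subgroup.center (Ginf W)

/-- The set of vertices `G_∞ / K_∞ Z_∞` of the tree `𝒯`; the group `G_∞` acts on it by left
multiplication. -/
abbrev Vert : Type _ := Ginf W ⧸ KZ W

/-- The vertex represented by a matrix. -/
def vert (g : Ginf W) : Vert W := QuotientGroup.mk g

/-- Adjacency in the tree `𝒯`: the classes of `g₁` and `g₂` are adjacent if `g₁⁻¹ g₂` is
equivalent modulo `K_∞ Z_∞` to `psl t b` with `b ∈ 𝒪_∞` (the class of `psl t b` depends
only on `b` modulo `t`) or to `psl t⁻¹ 0`. -/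
def Adj (v w : Vert W) : Prop :=
  ∃ g₁ g₂ : Ginf W, v = vert W g₁ ∧ w = vert W g₂ ∧
    ((∃ b ∈ Valued.integer (Finf W), vert W (g₁⁻¹ * g₂) = vert W (psl (t W) b)) ∨
      vert W (g₁⁻¹ * g₂) = vert W (psl (t W)⁻¹ 0))

/-- The Hecke operator `Φ_∞`: summation over the neighbouring vertices in `𝒯`. -/
def Phi (f : Vert W → ℂ) (v : Vert W) : ℂ := ∑ᶠ (w : Vert W) (_ : Adj W v w), f w

/-- Functions on the vertices of the quotient graph `Γ \ 𝒯`, viewed as functions on the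
vertices of `𝒯` that are invariant under `Γ`. -/
def IsGamInvariant (f : Vert W → ℂ) : Prop := ∀ γ ∈ Gam W, ∀ v : Vert W, f (γ • v) = f v

/-- The unipotent matrix with rows `(1, x)` and `(0, 1)`. -/
def unip (x : Finf W) : Ginf W := psl 1 x

/-- The lattice of those `x ∈ F_∞` for which `γ (1, x; 0, 1) γ⁻¹` lies in `Γ`. -/
def cuspLattice (γ : GL (Fin 2) (F W)) : AddSubgroup (Finf W) where
  carrier := {x | Matrix.GeneralLinearGroup.map (toFinf W) γ * unip W x *
    (Matrix.GeneralLinearGroup.map (toFinf W) γ)⁻¹ ∈ Gam W}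
  zero_mem' := by
    have h : unip W 0 = 1 := by
      ext i j; fin_cases i <;> fin_cases j <;> simp [unip, psl]
    simp [h, one_mem]
  add_mem' {x y} hx hy := by
    have h : unip W (x + y) = unip W x * unip W y := by
      ext i j; fin_cases i <;> fin_cases j <;> simp [unip, psl, Matrix.mul_apply, add_comm]
    rw [Set.mem_ofPred_eq] at hx hy ⊢
    have := mul_mem hx hy
    rw [h]
    convert this using 1
    group
  neg_mem' {x} hx := by
    have h : unip W (-x) = (unip W x)⁻¹ := by
      rw [eq_inv_iff_mul_eq_one]
      ext i j; fin_cases i <;> fin_cases j <;> simp [unip, psl, Matrix.mul_apply]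
    rw [Set.mem_ofPred_eq] at hx ⊢
    have := inv_mem hx
    rw [h]
    convert this using 1
    group

/-- A (`Γ`-invariant) function is a cusp form if all its constant terms vanish: for the
unipotent radical of every Borel subgroup of `GL₂` defined over `F` (that is, for every
`γ ∈ GL₂(F)`), the integral of `x ↦ f(γ (1, x; 0, 1) g)` over the compact group
`F_∞ / Λ_γ` with respect to Haar measure is zero for all `g ∈ G_∞`. As `f` is
invariant under `Γ`, the integrand does not depend on the representative `x.out` of `x`. -/
def IsCuspForm (f : Vert W → ℂ) : Prop :=
  ∀ (γ : GL (Fin 2) (F W)) (g : Ginf W),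
    letI : MeasurableSpace (Finf W ⧸ cuspLattice W γ) := borel _
    ∀ μ : MeasureTheory.Measure (Finf W ⧸ cuspLattice W γ), μ.IsAddHaarMeasure →
      ∫ x, f (vert W (Matrix.GeneralLinearGroup.map (toFinf W) γ * unip W x.out * g)) ∂μ = 0

/-- The vertices `c_n` for `n ≥ 0`. -/
def c (n : ℕ) : Vert W := vert W (psl ((t W)⁻¹ ^ n) 0)

/-- The vertex `z_0`. -/
def z0 : Vert W := vert W (psl 1 ((t W)⁻¹ : (Finf W)ˣ))

/-- The vertex `z_1`. -/
def z1 : Vert W := vert W (psl (t W) ((t W)⁻¹ : (Finf W)ˣ))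

/-- The vertices `t_1, …, t_q`, indexed by the elements `ℓ` of the field `k` with `q` elements:
these are the first coordinates of the points of the curve of degree two, each occurring for
one pair of opposite points. -/
def tv (l : k) : Vert W :=
  vert W (psl (t W ^ 2)
    (((t W)⁻¹ : (Finf W)ˣ) + AtoFinf W (algebraMap k (A W) l) * (t W : Finf W)))

/-- The function `f` is supported on the vertices of the quotient graph `Γ \ 𝒯` represented
by the `t_j`. -/
def SupportedOnT (f : Vert W → ℂ) : Prop :=
  ∀ v, f v ≠ 0 → ∃ l : k, ∃ γ ∈ Gam W, v = γ • tv W l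

/-- `S` is a `Φ_∞`-stable space of functions on `Γ \ 𝒯` which, for some constants
`lam`, `mu`, `nu`, consists of all the functions whose values at the vertices `t_j`, `z_0`, `z_1`
are arbitrary and whose values at the vertices `c_n` are given by the formula below;
for `n = 0` the formula is `f(c_0) = -2 (f(t_1) + ⋯ + f(t_q))`. -/
def IsSpaceS [Fintype k] (S : Submodule ℂ (Vert W → ℂ)) : Prop :=
  (∀ f ∈ S, Phi W f ∈ S) ∧
  ∃ lam mu nu : ℕ → ℂ, lam 0 = 0 ∧ mu 0 = -2 ∧
    ∀ f : Vert W → ℂ, f ∈ S ↔ IsGamInvariant W f ∧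
      ∀ n : ℕ, f (c W n) =
        if Even n then lam n * f (z0 W) + mu n * ∑ l : k, f (tv W l) else nu n * f (z1 W)

end EllTree

end

/-! The vertex `pv W n b` is said to have level n. Two properties of the curve matter most. The pole
orders at ∞ of elements of A omit exactly the value 1 (genus one), and there is no affine rational
point, so A has class number one.

Because of the gap, F_∞ = A + k t⁻¹ + 𝒪_∞, and the class in k t⁻¹ is unique. Hence the vertices of
level at most 0 reduce to the c_n and z_0, and walking outwards adds z_1 and the t_l. The outer
neighbours of t_l are represented by the fractions (y - e)/(x - l). The Weierstrass equation at (l,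
e) takes a non-zero constant value, which is the determinant of an element of Γ folding that
neighbour back to z_1 (`GRel.pv_three`). So the quotient graph is a half line c_0, c_1, …, with a
path from c_1 through z_0 to z_1, and q end vertices t_l attached to z_1 (`exists_rep`). Short
vectors of the associated lattices show that these vertices are distinct (`rep_injective`).

Applying the relation for f(c_n) to Φf yields the relation for f(c_{n+1}), so stability leaves one
choice of the constants (`le_spaceS`, `eq_spaceS`). An element of S is then given by its q + 2
values at z_0, z_1 and the t_l (`evalS_bijective`). Write T for the sum of the f(t_l). In these
coordinates Φ sends f(z_0) to -q f(z_1), f(z_1) to f(z_0) + T and f(t_l) to (q + 1) f(z_1). Thus Φ²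
multiplies f(z_1) by q², and the eigenvalues are q, -q, and 0 on the q-dimensional kernel f(z_1) =
f(z_0) + T = 0.

Class number one leaves a single cusp, so cuspidality concerns the integrals J_n of b ↦ f(`pv W n
b`) over F_∞/A (`exists_cusp_data`, `cusp_integrand`). For n < 0 the integrand is the constant
f(c_{-n}), and J_0 is proportional to f(c_0) + (q - 1) f(z_0). Their vanishing forces f(z_0) =
f(z_1) = T = 0 inside S. Conversely such an f is killed by Φ, and J_{n-1} + q J_{n+1} = 0 carries
the vanishing from n ≤ 0 to all levels (`isCuspForm_iff`). -/

noncomputable section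

namespace EllTree

open WeierstrassCurve.Affine Polynomial

variable {k : Type*} [Field k]

/-! ### The valuation at infinity on `A` and its values -/

section

variable (W : WeierstrassCurve k)

/-- The valuation of `F_∞`. -/
abbrev vInf : Valuation (Finf W) ℤᵐ⁰ := Valued.v

lemma lt_exp_iff_le {a : ℤᵐ⁰} {n : ℤ} : a < WithZero.exp n ↔ a ≤ WithZero.exp (n - 1) := by
  have h := WithZero.lt_mul_exp_iff_le (x := a) (y := WithZero.exp (n - 1)) WithZero.exp_ne_zero
  rwa [← WithZero.exp_add, sub_add_cancel] at h

lemma vInf_toFinf (z : F W) : vInf W (toFinf W z) = valInf W z := by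
  exact Valued.valuedCompletion_apply (K := WithVal (valInf W)) (WithVal.toVal (valInf W) z)

lemma vInf_AtoFinf (f : A W) : vInf W (AtoFinf W f) = valA W f := by
  rw [AtoFinf, RingHom.comp_apply, vInf_toFinf, valInf,
    Valuation.extendToLocalization_apply_map_apply]

lemma valA_apply {f : A W} (hf : f ≠ 0) :
    valA W f = WithZero.exp ((Algebra.norm k[X] f).natDegree : ℤ) := by
  change absInf W f = _
  simp [absInf, hf]

lemma AtoFinf_injective : Function.Injective (AtoFinf W) := by
  rw [injective_iff_map_eq_zero]
  intro f hf
  by_contra h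
  exact AtoFinf_ne_zero W h hf

lemma valA_polynomial {p : k[X]} (hp : p ≠ 0) :
    valA W (algebraMap k[X] (A W) p) = WithZero.exp (2 * p.natDegree : ℤ) := by
  have h0 : algebraMap k[X] (A W) p ≠ 0 := by
    simpa using (FaithfulSMul.algebraMap_injective k[X] (A W)).ne hp
  have h := Algebra.norm_algebraMap_of_basis (CoordinateRing.basis W.toAffine) p
  rw [valA_apply W h0, h, natDegree_pow]
  simp

lemma valA_const {a : k} (ha : a ≠ 0) : valA W (algebraMap k (A W) a) = 1 := by
  have h := valA_polynomial W (p := C a) (by simpa using ha)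
  rw [natDegree_C] at h
  simpa [IsScalarTower.algebraMap_apply k k[X] (A W)] using h

lemma valA_xA : valA W (xA W) = WithZero.exp 2 := by
  rw [xA, valA_polynomial W X_ne_zero, natDegree_X]
  rfl

lemma valA_yA : valA W (yA W) = WithZero.exp 3 := by
  have h := CoordinateRing.degree_norm_smul_basis (W' := W.toAffine) 0 1
  rw [zero_smul, zero_add, one_smul] at h
  rw [valA_apply W (yA_ne_zero W)]
  have : (Algebra.norm k[X] (yA W)).natDegree = 3 := by
    apply natDegree_eq_of_degree_eq_some
    rw [yA]
    simpa using h
  simp [this]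

lemma exists_eq_polynomial_add (f : A W) :
    ∃ p q : k[X], f = algebraMap k[X] (A W) p + algebraMap k[X] (A W) q * yA W := by
  obtain ⟨p, q, h⟩ := CoordinateRing.exists_smul_basis_eq f
  refine ⟨p, q, ?_⟩
  rw [← h, Algebra.smul_def, Algebra.smul_def, mul_one, yA]

lemma valA_polynomial_mul_yA {q : k[X]} (hq : q ≠ 0) :
    valA W (algebraMap k[X] (A W) q * yA W) = WithZero.exp (2 * q.natDegree + 3 : ℤ) := by
  rw [map_mul, valA_polynomial W hq, valA_yA, ← WithZero.exp_add]

/-- The pole orders 2 deg p and 2 deg q + 3 differ in parity, so the two parts of p + q y never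
cancel and the ultrametric inequality for the sum is an equality. -/
lemma valA_polynomial_ne {p q : k[X]} (hp : p ≠ 0) (hq : q ≠ 0) :
    valA W (algebraMap k[X] (A W) p) ≠ valA W (algebraMap k[X] (A W) q * yA W) := by
  rw [valA_polynomial W hp, valA_polynomial_mul_yA W hq, Ne, WithZero.exp_inj]
  omega

lemma eq_of_valA_le {f : A W} (hf : valA W f ≤ WithZero.exp 2) :
    ∃ a b : k, f = algebraMap k (A W) a + algebraMap k (A W) b * xA W := by
  obtain ⟨p, q, rfl⟩ := exists_eq_polynomial_add W f
  have key : q = 0 := by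
    by_contra hq
    have h3 : WithZero.exp (3 : ℤ) ≤ valA W (algebraMap k[X] (A W) q * yA W) := by
      rw [valA_polynomial_mul_yA W hq, WithZero.exp_le_exp]; omega
    by_cases hp : p = 0
    · rw [hp, map_zero, zero_add] at hf
      exact absurd (h3.trans hf) (by simp)
    · rw [Valuation.map_add_of_distinct_val _ (valA_polynomial_ne W hp hq)] at hf
      exact absurd (h3.trans ((le_max_right _ _).trans hf)) (by simp)
  subst key
  simp only [map_zero, zero_mul, add_zero] at hf ⊢
  by_cases hp : p = 0
  · exact ⟨0, 0, by simp [hp]⟩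
  rw [valA_polynomial W hp, WithZero.exp_le_exp] at hf
  have h1 : p.natDegree ≤ 1 := by omega
  refine ⟨p.coeff 0, p.coeff 1, ?_⟩
  conv_lhs => rw [eq_X_add_C_of_natDegree_le_one h1]
  rw [map_add, map_mul, xA, IsScalarTower.algebraMap_apply k k[X] (A W),
    IsScalarTower.algebraMap_apply k k[X] (A W), add_comm]
  rfl

lemma eq_const_of_valA_le {f : A W} (hf : valA W f ≤ 1) :
    ∃ a : k, f = algebraMap k (A W) a := by
  obtain ⟨a, b, rfl⟩ := eq_of_valA_le W (hf.trans (by simp [← WithZero.exp_zero]))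
  refine ⟨a, ?_⟩
  by_cases hb : b = 0
  · simp [hb]
  exfalso
  have h2 : valA W (algebraMap k (A W) b * xA W) = WithZero.exp 2 := by
    rw [map_mul, valA_const W hb, valA_xA, one_mul]
  have ha : valA W (algebraMap k (A W) a) ≤ 1 := by
    by_cases h : a = 0
    · simp [h]
    · exact (valA_const W h).le
  rw [Valuation.map_add_eq_of_lt_right, h2] at hf
  · exact absurd hf (by simp [← WithZero.exp_zero])
  · rw [h2]
    exact ha.trans_lt (by simp [← WithZero.exp_zero])

/-- The Weierstrass gap of genus one. It accounts for the extra class k t⁻¹ in F_∞ / (A + 𝒪_∞),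
hence for the vertices of the quotient outside the half line. -/
lemma valA_ne_exp_one (f : A W) : valA W f ≠ WithZero.exp 1 := by
  by_cases hf : f = 0
  · rw [hf, map_zero]
    exact WithZero.exp_ne_zero.symm
  rw [valA_apply W hf, Ne, WithZero.exp_inj]
  have := CoordinateRing.natDegree_norm_ne_one (W' := W.toAffine) f
  exact_mod_cast this

lemma one_le_valA {f : A W} (hf : f ≠ 0) : 1 ≤ valA W f := by
  rw [valA_apply W hf, ← WithZero.exp_zero, WithZero.exp_le_exp]
  positivity

/-- A constant, as an element of `F_∞`. -/
def cst : k →+* Finf W := (AtoFinf W).comp (algebraMap k (A W))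

lemma cst_apply (a : k) : cst W a = AtoFinf W (algebraMap k (A W) a) := rfl

lemma vInf_cst {a : k} (ha : a ≠ 0) : vInf W (cst W a) = 1 := by
  rw [cst_apply, vInf_AtoFinf, valA_const W ha]

lemma vInf_cst_le (a : k) : vInf W (cst W a) ≤ 1 := by
  by_cases h : a = 0
  · simp [h]
  · exact (vInf_cst W h).le

/-- The function `x`, as an element of `F_∞`. -/
def xInf : Finf W := AtoFinf W (xA W)

/-- The function `y`, as an element of `F_∞`. -/
def yInf : Finf W := AtoFinf W (yA W)

/-- The uniformizer `t`, as an element of `F_∞`. -/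
def tInf : Finf W := (t W : Finf W)

lemma vInf_xInf : vInf W (xInf W) = WithZero.exp 2 := by
  rw [xInf, vInf_AtoFinf, valA_xA]

lemma vInf_yInf : vInf W (yInf W) = WithZero.exp 3 := by
  rw [yInf, vInf_AtoFinf, valA_yA]

lemma xInf_ne_zero : xInf W ≠ 0 := AtoFinf_ne_zero W (xA_ne_zero W)

lemma yInf_ne_zero : yInf W ≠ 0 := AtoFinf_ne_zero W (yA_ne_zero W)

lemma tInf_eq : tInf W = xInf W / yInf W := by
  rw [tInf, t, Units.val_mul, div_eq_mul_inv, Units.val_inv_eq_inv_val]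
  rfl

lemma tInf_ne_zero : tInf W ≠ 0 := (t W).ne_zero

lemma vInf_tInf_zpow (n : ℤ) : vInf W (tInf W ^ n) = WithZero.exp (-n) := by
  rw [map_zpow₀, tInf_eq, map_div₀, vInf_xInf, vInf_yInf, ← WithZero.exp_sub, ← WithZero.exp_zsmul]
  congr 1
  simp

lemma vInf_tInf : vInf W (tInf W) = WithZero.exp (-1) := by
  simpa using vInf_tInf_zpow W 1

lemma curve_eqn : yInf W ^ 2 + cst W W.a₁ * xInf W * yInf W + cst W W.a₃ * yInf W =
    xInf W ^ 3 + cst W W.a₂ * xInf W ^ 2 + cst W W.a₄ * xInf W + cst W W.a₆ := by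
  have h : yA W ^ 2 + algebraMap k (A W) W.a₁ * xA W * yA W + algebraMap k (A W) W.a₃ * yA W =
    xA W ^ 3 + algebraMap k (A W) W.a₂ * xA W ^ 2 + algebraMap k (A W) W.a₄ * xA W +
      algebraMap k (A W) W.a₆ := by
    have h1 : CoordinateRing.mk W.toAffine W.toAffine.polynomial = 0 := AdjoinRoot.mk_self
    change CoordinateRing.mk W.toAffine (X ^ 2 + C (C W.a₁ * X + C W.a₃) * X -
      C (X ^ 3 + C W.a₂ * X ^ 2 + C W.a₄ * X + C W.a₆)) = 0 at h1
    simp only [map_add, map_sub, map_mul, map_pow] at h1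
    rw [← sub_eq_zero, ← h1]
    simp only [IsScalarTower.algebraMap_apply k k[X] (A W), yA, xA]
    change _ = (CoordinateRing.mk W.toAffine) X ^ 2 + (algebraMap k[X] (A W) (C W.a₁) *
      algebraMap k[X] (A W) X + algebraMap k[X] (A W) (C W.a₃)) * (CoordinateRing.mk W.toAffine) X -
      (algebraMap k[X] (A W) X ^ 3 + algebraMap k[X] (A W) (C W.a₂) * algebraMap k[X] (A W) X ^ 2 +
        algebraMap k[X] (A W) (C W.a₄) * algebraMap k[X] (A W) X + algebraMap k[X] (A W) (C W.a₆))
    simp only [Polynomial.algebraMap_eq]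
    ring
  simpa [xInf, yInf, cst_apply] using congrArg (AtoFinf W) h

end

/-! ### Leading terms in the completion -/

section

variable (W : WeierstrassCurve k)

/-- `z` has a leading term `a tⁿ` with `a` a non-zero constant. -/
def HasLead (z : Finf W) : Prop :=
  ∃ (n : ℤ) (a : k), a ≠ 0 ∧ vInf W (z - cst W a * tInf W ^ n) < WithZero.exp (-n)

lemma vInf_cst_mul_tInf_zpow {a : k} (ha : a ≠ 0) (n : ℤ) :
    vInf W (cst W a * tInf W ^ n) = WithZero.exp (-n) := by
  rw [map_mul, vInf_cst W ha, one_mul, vInf_tInf_zpow]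

variable {W}

lemma vInf_eq_of_lead {z : Finf W} {n : ℤ} {a : k} (ha : a ≠ 0)
    (h : vInf W (z - cst W a * tInf W ^ n) < WithZero.exp (-n)) :
    vInf W z = WithZero.exp (-n) := by
  rw [← vInf_cst_mul_tInf_zpow W ha] at h ⊢
  exact Valuation.map_eq_of_sub_lt _ h

lemma HasLead.mul {z w : Finf W} (hz : HasLead W z) (hw : HasLead W w) : HasLead W (z * w) := by
  obtain ⟨n, a, ha, h⟩ := hz
  obtain ⟨m, b, hb, h'⟩ := hw
  refine ⟨n + m, a * b, mul_ne_zero ha hb, ?_⟩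
  have e : z * w - cst W (a * b) * tInf W ^ (n + m) =
      z * (w - cst W b * tInf W ^ m) + (z - cst W a * tInf W ^ n) * (cst W b * tInf W ^ m) := by
    rw [zpow_add₀ (tInf_ne_zero W), map_mul]; ring
  rw [e]
  have e2 : WithZero.exp (-(n + m)) = WithZero.exp (-n) * WithZero.exp (-m) := by
    rw [← WithZero.exp_add]; congr 1; ring
  refine Valuation.map_add_lt _ ?_ ?_
  · rw [map_mul, vInf_eq_of_lead ha h, e2]
    exact mul_lt_mul_of_pos_left h' WithZero.exp_pos
  · rw [map_mul, vInf_cst_mul_tInf_zpow W hb, e2]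
    exact mul_lt_mul_of_pos_right h WithZero.exp_pos

lemma HasLead.ne_zero {z : Finf W} (hz : HasLead W z) : z ≠ 0 := by
  obtain ⟨n, a, ha, h⟩ := hz
  rintro rfl
  have := vInf_eq_of_lead ha h
  rw [map_zero] at this
  exact WithZero.exp_ne_zero this.symm

lemma HasLead.inv {z : Finf W} (hz : HasLead W z) : HasLead W z⁻¹ := by
  have h0 := hz.ne_zero
  obtain ⟨n, a, ha, h⟩ := hz
  refine ⟨-n, a⁻¹, inv_ne_zero ha, ?_⟩
  have hm : cst W a * tInf W ^ n ≠ 0 :=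
    mul_ne_zero ((_root_.map_ne_zero _).mpr ha) (zpow_ne_zero _ (tInf_ne_zero W))
  have e : z⁻¹ - cst W a⁻¹ * tInf W ^ (-n) =
      -((z - cst W a * tInf W ^ n) * (z⁻¹ * (cst W a * tInf W ^ n)⁻¹)) := by
    rw [map_inv₀, zpow_neg, ← mul_inv, sub_mul, ← mul_assoc, mul_inv_cancel₀ h0, mul_comm z⁻¹,
      ← mul_assoc, mul_inv_cancel₀ hm]
    ring
  rw [e, Valuation.map_neg, map_mul, map_mul, map_inv₀, map_inv₀, vInf_eq_of_lead ha h,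
    vInf_cst_mul_tInf_zpow W ha, ← WithZero.exp_neg, neg_neg, ← WithZero.exp_add]
  calc _ < WithZero.exp (-n) * WithZero.exp (n + n) := mul_lt_mul_of_pos_right h WithZero.exp_pos
    _ = _ := by rw [← WithZero.exp_add]; congr 1; ring

lemma HasLead.of_sub_lt {z w : Finf W} (hz : HasLead W z) (h : vInf W (w - z) < vInf W z) :
    HasLead W w := by
  obtain ⟨n, a, ha, h'⟩ := hz
  refine ⟨n, a, ha, ?_⟩
  rw [vInf_eq_of_lead ha h'] at h
  have e : w - cst W a * tInf W ^ n = (w - z) + (z - cst W a * tInf W ^ n) := by ring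
  rw [e]
  exact Valuation.map_add_lt _ h h'

lemma hasLead_cst {a : k} (ha : a ≠ 0) : HasLead W (cst W a) :=
  ⟨0, a, ha, by simp⟩

lemma HasLead.pow {z : Finf W} (hz : HasLead W z) (n : ℕ) : HasLead W (z ^ n) := by
  induction n with
  | zero => simpa using hasLead_cst (W := W) one_ne_zero
  | succ n ih => rw [pow_succ]; exact ih.mul hz

lemma hasLead_tInf_zpow (n : ℤ) : HasLead W (tInf W ^ n) :=
  ⟨n, 1, one_ne_zero, by simp⟩

variable (W)

/-- In the Weierstrass equation every monomial other than y² and x³ has a pole of order at most 5 at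
∞, while those two have order 6. -/
lemma vInf_curve_rest : vInf W (yInf W ^ 2 - xInf W ^ 3) ≤ WithZero.exp 5 := by
  have e : yInf W ^ 2 - xInf W ^ 3 = cst W W.a₂ * xInf W ^ 2 + cst W W.a₄ * xInf W + cst W W.a₆
      - cst W W.a₁ * xInf W * yInf W - cst W W.a₃ * yInf W := by
    linear_combination curve_eqn W
  have hc : ∀ (a : k) (z : Finf W), vInf W z ≤ WithZero.exp 5 →
      vInf W (cst W a * z) ≤ WithZero.exp 5 := by
    intro a z hz
    rw [map_mul]
    exact (mul_le_mul_left (vInf_cst_le W a) _).trans (by rwa [one_mul])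
  rw [e]
  refine (Valuation.map_sub_le _ ?_ ?_)
  · refine (Valuation.map_sub_le _ ?_ ?_)
    · refine Valuation.map_add_le _ (Valuation.map_add_le _ ?_ ?_) ?_
      · apply hc
        rw [map_pow, vInf_xInf, ← WithZero.exp_nsmul, WithZero.exp_le_exp]; simp
      · apply hc
        rw [vInf_xInf, WithZero.exp_le_exp]; simp
      · refine (vInf_cst_le W _).trans ?_
        rw [← WithZero.exp_zero, WithZero.exp_le_exp]; simp
    · rw [mul_assoc]
      apply hc
      rw [map_mul, vInf_xInf, vInf_yInf, ← WithZero.exp_add, WithZero.exp_le_exp]; simp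
  · apply hc
    rw [vInf_yInf, WithZero.exp_le_exp]; simp

/-- Since t⁻² = y²/x², the difference x - t⁻² is -(y² - x³)/x², with a pole of order at most 5 - 4 =
1. So x has leading term t⁻². -/
lemma hasLead_xInf : HasLead W (xInf W) := by
  refine HasLead.of_sub_lt (hasLead_tInf_zpow (-2)) ?_
  have e : xInf W - tInf W ^ (-2 : ℤ) = -((yInf W ^ 2 - xInf W ^ 3) * (xInf W ^ 2)⁻¹) := by
    have := xInf_ne_zero W
    have := yInf_ne_zero W
    rw [tInf_eq, zpow_neg, ← inv_zpow, inv_div]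
    field_simp
    ring
  rw [e, Valuation.map_neg, map_mul, map_inv₀, map_pow, vInf_xInf, vInf_tInf_zpow,
    ← WithZero.exp_nsmul, ← WithZero.exp_neg]
  calc _ ≤ WithZero.exp 5 * WithZero.exp (-(2 • 2)) := mul_le_mul_left (vInf_curve_rest W) _
    _ < _ := by rw [← WithZero.exp_add, WithZero.exp_lt_exp]; simp

lemma hasLead_yInf : HasLead W (yInf W) := by
  have e : yInf W = xInf W * (tInf W ^ (1 : ℤ))⁻¹ := by
    rw [zpow_one, tInf_eq, inv_div, mul_div_cancel₀ _ (xInf_ne_zero W)]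
  rw [e]
  exact (hasLead_xInf W).mul (hasLead_tInf_zpow 1).inv

lemma hasLead_polynomial {p : k[X]} (hp : p ≠ 0) :
    HasLead W (AtoFinf W (algebraMap k[X] (A W) p)) := by
  have h1 : HasLead W (AtoFinf W (algebraMap k[X] (A W) (C p.leadingCoeff * X ^ p.natDegree))) := by
    have := (hasLead_cst (W := W) (leadingCoeff_ne_zero.mpr hp)).mul
      ((hasLead_xInf W).pow p.natDegree)
    convert this using 1
    rw [map_mul, map_mul, map_pow, map_pow]
    rfl
  refine h1.of_sub_lt ?_
  rw [← map_sub, ← map_sub, vInf_AtoFinf, vInf_AtoFinf]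
  have e : p - C p.leadingCoeff * X ^ p.natDegree = p.eraseLead := self_sub_C_mul_X_pow p
  rw [e]
  have h2 : C p.leadingCoeff * X ^ p.natDegree ≠ 0 := by simpa using hp
  rw [valA_polynomial W h2, natDegree_C_mul_X_pow _ _ (leadingCoeff_ne_zero.mpr hp)]
  by_cases h3 : p.eraseLead = 0
  · rw [h3, map_zero, map_zero]; exact WithZero.exp_pos
  rw [valA_polynomial W h3, WithZero.exp_lt_exp]
  have h4 : p.natDegree ≠ 0 := by
    intro h
    apply h3
    rw [eq_C_of_natDegree_eq_zero h, eraseLead_C]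
  have := eraseLead_natDegree_le p
  omega

lemma hasLead_AtoFinf {f : A W} (hf : f ≠ 0) : HasLead W (AtoFinf W f) := by
  obtain ⟨p, q, rfl⟩ := exists_eq_polynomial_add W f
  have hy : ∀ {q : k[X]}, q ≠ 0 → HasLead W (AtoFinf W (algebraMap k[X] (A W) q * yA W)) := by
    intro q hq
    rw [map_mul]
    exact (hasLead_polynomial W hq).mul (hasLead_yInf W)
  by_cases hp : p = 0
  · by_cases hq : q = 0
    · simp [hp, hq] at hf
    · simpa only [hp, map_zero, zero_add] using hy hq
  by_cases hq : q = 0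
  · simpa only [hq, map_zero, zero_mul, add_zero] using hasLead_polynomial W hp
  rcases lt_or_gt_of_ne (valA_polynomial_ne W hp hq) with h | h
  · refine (hy hq).of_sub_lt ?_
    rw [map_add, add_sub_cancel_right, vInf_AtoFinf, vInf_AtoFinf]
    exact h
  · refine (hasLead_polynomial W hp).of_sub_lt ?_
    rw [map_add, add_sub_cancel_left, vInf_AtoFinf, vInf_AtoFinf]
    exact h

lemma hasLead_toFinf {z : F W} (hz : z ≠ 0) : HasLead W (toFinf W z) := by
  obtain ⟨a, b, hb, rfl⟩ := IsFractionRing.div_surjective (A := A W) z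
  rw [map_div₀, div_eq_mul_inv]
  refine HasLead.mul (hasLead_AtoFinf W ?_) (hasLead_AtoFinf W (nonZeroDivisors.ne_zero hb)).inv
  rintro rfl
  simp at hz

lemma ball_mem_nhds (z : Finf W) {w : Finf W} (hw : w ≠ 0) :
    {y | vInf W (y - z) < vInf W w} ∈ nhds z := by
  have hw' : (vInf W).restrict w ≠ 0 := by simpa using hw
  exact Valued.mem_nhds.mpr ⟨Units.mk0 _ hw', fun y hy ↦ (vInf W).restrict_lt_iff.mp hy⟩

/-- Leading terms depend only on an element up to strictly smaller error, and they are
multiplicative; they are known on A, pass to quotients, and reach F_∞ by density of F. In effect k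
is the residue field and t generates the value group. -/
lemma hasLead {z : Finf W} (hz : z ≠ 0) : HasLead W z := by
  have hd : DenseRange (toFinf W) :=
    (UniformSpace.Completion.denseRange_coe (α := WithVal (valInf W))).comp
      (WithVal.equiv (valInf W)).symm.surjective.denseRange (UniformSpace.Completion.continuous_coe _)
  obtain ⟨r, hr⟩ := hd.exists_mem_open isOpen_interior
    ⟨z, mem_interior_iff_mem_nhds.mpr (ball_mem_nhds W z hz)⟩
  have hr := interior_subset hr
  rw [Set.mem_ofPred_eq] at hr
  have hv := Valuation.map_eq_of_sub_lt _ hr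
  refine (hasLead_toFinf W (z := r) ?_).of_sub_lt ?_
  · rintro rfl
    rw [map_zero, map_zero] at hv
    exact hz ((Valuation.zero_iff _).mp hv.symm)
  · rwa [Valuation.map_sub_swap, hv]

end

/-! ### Approximation and compactness -/

section

variable (W : WeierstrassCurve k)

lemma exists_vInf_eq {z : Finf W} (hz : z ≠ 0) : ∃ n : ℤ, vInf W z = WithZero.exp n := by
  obtain ⟨n, a, ha, h⟩ := hasLead W hz
  exact ⟨-n, vInf_eq_of_lead ha h⟩

lemma exists_cst_approx {z : Finf W} {n : ℤ} (hz : vInf W z ≤ WithZero.exp (-n)) :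
    ∃ a : k, vInf W (z - cst W a * tInf W ^ n) ≤ WithZero.exp (-n - 1) := by
  rcases hz.lt_or_eq with h | h
  · exact ⟨0, by simpa using lt_exp_iff_le.mp h⟩
  have h0 : z ≠ 0 := by
    rintro rfl
    rw [map_zero] at h
    exact WithZero.exp_ne_zero h.symm
  obtain ⟨m, a, ha, h'⟩ := hasLead W h0
  have e := vInf_eq_of_lead ha h'
  rw [h, WithZero.exp_inj, neg_inj] at e
  subst e
  exact ⟨a, lt_exp_iff_le.mp h'⟩

lemma exists_valA_eq (n : ℕ) (hn : 2 ≤ n) : ∃ f : A W, valA W f = WithZero.exp (n : ℤ) := by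
  obtain ⟨m, rfl | rfl⟩ : ∃ m, n = 2 * m ∨ n = 2 * m + 3 := by
    rcases Nat.even_or_odd' n with ⟨m, h | h⟩
    · exact ⟨m, .inl h⟩
    · exact ⟨m - 1, .inr (by omega)⟩
  · refine ⟨xA W ^ m, ?_⟩
    rw [map_pow, valA_xA, ← WithZero.exp_nsmul]
    congr 1
    simp [mul_comm]
  · refine ⟨xA W ^ m * yA W, ?_⟩
    rw [map_mul, map_pow, valA_xA, valA_yA, ← WithZero.exp_nsmul, ← WithZero.exp_add]
    congr 1
    simp [mul_comm]

/-- `F_∞ = A + k t⁻¹ + 𝒪_∞`. -/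
lemma exists_decomp (z : Finf W) : ∃ (f : A W) (a : k),
    vInf W (z - AtoFinf W f - cst W a * (tInf W)⁻¹) ≤ 1 := by
  suffices H : ∀ (N : ℕ) (z : Finf W), vInf W z ≤ WithZero.exp (N : ℤ) → ∃ (f : A W) (a : k),
      vInf W (z - AtoFinf W f - cst W a * (tInf W)⁻¹) ≤ 1 by
    by_cases hz : z = 0
    · exact ⟨0, 0, by simp [hz]⟩
    obtain ⟨n, hn⟩ := exists_vInf_eq W hz
    refine H n.toNat z ?_
    rw [hn, WithZero.exp_le_exp]
    exact Int.self_le_toNat n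
  intro N
  induction N with
  | zero => intro z hz; exact ⟨0, 0, by simpa using hz⟩
  | succ N ih =>
    intro z hz
    obtain ⟨a, ha⟩ := exists_cst_approx W (n := -(N + 1 : ℤ)) (by simpa using hz)
    have ha : vInf W (z - cst W a * tInf W ^ (-(N + 1 : ℤ))) ≤ WithZero.exp (N : ℤ) := by
      simpa using ha
    rcases Nat.eq_zero_or_pos N with rfl | hN
    · exact ⟨0, a, by simpa using ha⟩
    -- Every pole order N + 1 ≥ 2 occurs in A, so a constant multiple of g removes the leading term.
    -- Only order 1 cannot be removed, which leaves the term in t⁻¹.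
    obtain ⟨g, hg⟩ := exists_valA_eq W (N + 1) (by omega)
    rw [← vInf_AtoFinf] at hg
    obtain ⟨b, hb⟩ := exists_cst_approx W (z := AtoFinf W g) (n := -(N + 1 : ℤ)) (by
      rw [hg]; simp)
    have hb : vInf W (AtoFinf W g - cst W b * tInf W ^ (-(N + 1 : ℤ))) ≤ WithZero.exp (N : ℤ) := by
      simpa using hb
    have hb0 : b ≠ 0 := by
      rintro rfl
      rw [map_zero, zero_mul, sub_zero, hg, WithZero.exp_le_exp] at hb
      push_cast at hb
      omega
    obtain ⟨f, c, hf⟩ := ih (z - AtoFinf W (algebraMap k (A W) (a / b) * g)) (by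
      have e : z - AtoFinf W (algebraMap k (A W) (a / b) * g) =
          (z - cst W a * tInf W ^ (-(N + 1 : ℤ))) -
          cst W (a / b) * (AtoFinf W g - cst W b * tInf W ^ (-(N + 1 : ℤ))) := by
        rw [map_mul, ← cst_apply, mul_sub, ← mul_assoc, ← map_mul, div_mul_cancel₀ _ hb0]
        ring
      rw [e]
      refine Valuation.map_sub_le _ ha ?_
      rw [map_mul]
      exact (mul_le_mul_left (vInf_cst_le W _) _).trans (by rwa [one_mul]))
    refine ⟨algebraMap k (A W) (a / b) * g + f, c, ?_⟩
    rwa [map_add, ← sub_sub]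

/-- If a were non-zero, f would have a pole of order exactly 1, which the gap excludes. This is the
uniqueness of the t⁻¹-coefficient in `exists_decomp`. -/
lemma eq_zero_of_decomp {f : A W} {a : k}
    (h : vInf W (cst W a * (tInf W)⁻¹ - AtoFinf W f) ≤ 1) : a = 0 := by
  by_contra ha
  have h1 : vInf W (cst W a * (tInf W)⁻¹) = WithZero.exp 1 := by
    simpa using vInf_cst_mul_tInf_zpow W ha (-1)
  have h2 : vInf W (AtoFinf W f) = WithZero.exp 1 := by
    rw [← h1]
    apply Valuation.map_eq_of_sub_lt
    rw [Valuation.map_sub_swap, h1]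
    refine h.trans_lt ?_
    simp [← WithZero.exp_zero]
  rw [vInf_AtoFinf] at h2
  exact valA_ne_exp_one W f h2

lemma mem_nhds_zero_iff {s : Set (Finf W)} :
    s ∈ nhds (0 : Finf W) ↔ ∃ n : ℕ, {z | vInf W z ≤ WithZero.exp (-n : ℤ)} ⊆ s := by
  constructor
  · intro h
    obtain ⟨γ, hγ⟩ := (Valued.mem_nhds_zero (R := Finf W)).mp h
    obtain ⟨w, hw⟩ := MonoidWithZeroHom.ValueGroup₀.restrict₀_surjective
      (MonoidWithZeroHom.ofClass (vInf W)) γ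
    rw [← hw] at hγ
    have hw0 : w ≠ 0 := by
      rintro rfl
      exact γ.ne_zero (by rw [← hw, map_zero])
    obtain ⟨m, hm⟩ := exists_vInf_eq W hw0
    refine ⟨(1 - m).toNat, fun z hz ↦ hγ ?_⟩
    refine (vInf W).restrict_lt_iff.mpr (lt_of_le_of_lt hz ?_)
    rw [hm, WithZero.exp_lt_exp]
    omega
  · rintro ⟨n, hn⟩
    have h := ball_mem_nhds W 0 (w := tInf W ^ (n : ℤ)) (zpow_ne_zero _ (tInf_ne_zero W))
    refine Filter.mem_of_superset h fun z hz ↦ hn ?_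
    rw [Set.mem_ofPred_eq, sub_zero, vInf_tInf_zpow] at hz
    exact hz.le

lemma exists_finite_cover [Finite k] (n : ℕ) : ∃ s : Set (Finf W), s.Finite ∧
    ∀ z, vInf W z ≤ 1 → ∃ w ∈ s, vInf W (z - w) ≤ WithZero.exp (-n : ℤ) := by
  induction n with
  | zero => exact ⟨{0}, Set.finite_singleton 0, fun z hz ↦ ⟨0, rfl, by simpa using hz⟩⟩
  | succ n ih =>
    obtain ⟨s, hs, h⟩ := ih
    refine ⟨Set.image2 (fun w a ↦ w + cst W a * tInf W ^ (n : ℤ)) s Set.univ,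
      hs.image2 _ Set.finite_univ, fun z hz ↦ ?_⟩
    obtain ⟨w, hw, hzw⟩ := h z hz
    obtain ⟨a, ha⟩ := exists_cst_approx W hzw
    refine ⟨_, ⟨w, hw, a, Set.mem_univ _, rfl⟩, ?_⟩
    rw [← sub_sub]
    convert ha using 2
    push_cast
    ring

/-- Finitely many truncated expansions in t approximate every integer to a given order, so 𝒪_∞ is
totally bounded; it is complete because it is closed. -/
lemma isCompact_integer [Finite k] : IsCompact {z : Finf W | vInf W z ≤ 1} := by
  rw [isCompact_iff_totallyBounded_isComplete]
  constructor
  · rw [totallyBounded_iff_subset_finite_iUnion_nhds_zero]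
    intro U hU
    obtain ⟨n, hn⟩ := (mem_nhds_zero_iff W).mp hU
    obtain ⟨s, hs, h⟩ := exists_finite_cover W n
    refine ⟨s, hs, fun z hz ↦ ?_⟩
    obtain ⟨w, hw, hzw⟩ := h z hz
    refine Set.mem_biUnion hw ⟨z - w, hn hzw, ?_⟩
    simp
  · exact IsClosed.isComplete (Valued.isClosed_integer (Finf W))

lemma vInf_xInf_sub_cst (l : k) : vInf W (xInf W - cst W l) = WithZero.exp 2 := by
  rw [← vInf_xInf W, Valuation.map_sub_eq_of_lt_left]
  rw [vInf_xInf]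
  refine (vInf_cst_le W l).trans_lt ?_
  simp [← WithZero.exp_zero]

lemma xInf_sub_cst_ne_zero (l : k) : xInf W - cst W l ≠ 0 := by
  intro h
  have := vInf_xInf_sub_cst W l
  rw [h, map_zero] at this
  exact WithZero.exp_ne_zero this.symm

lemma vInf_div_expansion (l : k) :
    vInf W (yInf W / (xInf W - cst W l) - ((tInf W)⁻¹ + cst W l * tInf W)) ≤
      WithZero.exp (-2) := by
  have hx := xInf_ne_zero W
  have hy := yInf_ne_zero W
  have hl := xInf_sub_cst_ne_zero W l
  -- With t = x/y the difference becomes a fraction whose numerator has a pole of order at most 5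
  -- and whose denominator has one of order 7.
  have e : yInf W / (xInf W - cst W l) - ((tInf W)⁻¹ + cst W l * tInf W) =
      cst W l * ((yInf W ^ 2 - xInf W ^ 3) + cst W l * xInf W ^ 2) *
        (xInf W * yInf W * (xInf W - cst W l))⁻¹ := by
    rw [tInf_eq]
    field_simp
    ring
  rw [e, map_mul, map_mul, map_inv₀, map_mul, map_mul, vInf_xInf, vInf_yInf, vInf_xInf_sub_cst]
  have h1 : vInf W ((yInf W ^ 2 - xInf W ^ 3) + cst W l * xInf W ^ 2) ≤ WithZero.exp 5 := by
    refine Valuation.map_add_le _ (vInf_curve_rest W) ?_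
    rw [map_mul, map_pow, vInf_xInf, ← WithZero.exp_nsmul]
    refine (mul_le_mul_left (vInf_cst_le W _) _).trans ?_
    rw [one_mul, WithZero.exp_le_exp]
    simp
  calc _ ≤ 1 * WithZero.exp (5 : ℤ) *
      (WithZero.exp (2 : ℤ) * WithZero.exp (3 : ℤ) * WithZero.exp (2 : ℤ))⁻¹ := by
        gcongr
        exact vInf_cst_le W l
    _ = _ := by
      rw [one_mul, ← WithZero.exp_add, ← WithZero.exp_add, ← WithZero.exp_neg, ← WithZero.exp_add]
      rfl

/-- Since 1/(x - l) has order exactly 2 at ∞, subtracting a constant from y changes the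
t²-coefficient of y/(x - l) to any prescribed value b and nothing of lower order. -/
lemma exists_div_approx (l b : k) : ∃ a : k,
    vInf W ((yInf W - cst W a) / (xInf W - cst W l) -
      ((tInf W)⁻¹ + cst W l * tInf W + cst W b * tInf W ^ 2)) ≤ WithZero.exp (-3) := by
  have hl := xInf_sub_cst_ne_zero W l
  set δ := yInf W / (xInf W - cst W l) - ((tInf W)⁻¹ + cst W l * tInf W + cst W b * tInf W ^ 2)
    with hδ
  have h1 : vInf W δ ≤ WithZero.exp (-2) := by
    rw [hδ, ← sub_sub]
    refine Valuation.map_sub_le _ (vInf_div_expansion W l) ?_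
    have h2 := vInf_tInf_zpow W 2
    rw [zpow_ofNat] at h2
    rw [map_mul, h2]
    exact (mul_le_mul_left (vInf_cst_le W _) _).trans (by rw [one_mul])
  obtain ⟨a, ha⟩ := exists_cst_approx W (z := δ * (xInf W - cst W l)) (n := 0) (by
    rw [map_mul, vInf_xInf_sub_cst]
    refine (mul_le_mul_left h1 _).trans ?_
    rw [← WithZero.exp_add, WithZero.exp_le_exp]
    simp)
  refine ⟨a, ?_⟩
  have e : (yInf W - cst W a) / (xInf W - cst W l) -
      ((tInf W)⁻¹ + cst W l * tInf W + cst W b * tInf W ^ 2) =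
      (δ * (xInf W - cst W l) - cst W a * tInf W ^ (0 : ℤ)) * (xInf W - cst W l)⁻¹ := by
    rw [sub_mul, mul_assoc, mul_inv_cancel₀ hl, hδ, zpow_zero]
    ring
  rw [e, map_mul, map_inv₀, vInf_xInf_sub_cst]
  refine (mul_le_mul_left ha _).trans ?_
  rw [← WithZero.exp_neg, ← WithZero.exp_add, WithZero.exp_le_exp]
  simp

end

/-! ### The vertices of the tree -/

section

variable (W : WeierstrassCurve k)

/-- Invertible matrices over `𝒪_∞`, as matrices over `F_∞`. -/
structure IsIntegralUnit (κ : Matrix (Fin 2) (Fin 2) (Finf W)) : Prop where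
  entry_le : ∀ i j, vInf W (κ i j) ≤ 1
  det_eq : vInf W κ.det = 1

lemma coe_psl {R : Type*} [CommRing R] (a : Rˣ) (b : R) :
    (psl a b : Matrix (Fin 2) (Fin 2) R) = !![(a : R), b; 0, 1] := rfl

lemma mem_Kinf_iff (g : Ginf W) : g ∈ Kinf W ↔ IsIntegralUnit W g := by
  constructor
  · rintro ⟨h, rfl⟩
    refine ⟨fun i j ↦ (h i j).2, ?_⟩
    have h1 : IsUnit (h : Matrix (Fin 2) (Fin 2) (Valued.integer (Finf W))).det :=
      (Matrix.isUnit_iff_isUnit_det _).mp h.isUnit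
    have h2 := ((Valuation.integer.integers (vInf W)).isUnit_iff_valuation_eq_one).mp h1
    rw [← h2]
    congr 1
  · intro hg
    let m : Matrix (Fin 2) (Fin 2) (Valued.integer (Finf W)) := fun i j ↦ ⟨g i j, hg.entry_le i j⟩
    have hm : (Valued.integer (Finf W)).subtype.mapMatrix m =
      (g : Matrix (Fin 2) (Fin 2) (Finf W)) := rfl
    have hdet : IsUnit m.det := by
      refine ((Valuation.integer.integers (vInf W)).isUnit_iff_valuation_eq_one).mpr ?_
      rw [← hg.det_eq, ← hm]
      congr 1
    exact ⟨Matrix.GeneralLinearGroup.mk'' m hdet, Units.ext hm⟩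

lemma mem_KZ_iff (g : Ginf W) : g ∈ KZ W ↔ ∃ (u : Finf W) (κ : Matrix (Fin 2) (Fin 2) (Finf W)),
    u ≠ 0 ∧ IsIntegralUnit W κ ∧ (g : Matrix (Fin 2) (Fin 2) (Finf W)) = u • κ := by
  rw [KZ, Subgroup.mem_sup_of_normal_right]
  constructor
  · rintro ⟨κ, hκ, z, hz, rfl⟩
    rw [mem_Kinf_iff] at hκ
    rw [Matrix.GeneralLinearGroup.mem_center_iff_val_mem_range_scalar] at hz
    obtain ⟨u, hu⟩ := hz
    refine ⟨u, κ, ?_, hκ, ?_⟩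
    · rintro rfl
      rw [map_zero] at hu
      exact z.ne_zero hu.symm
    · rw [Units.val_mul, ← hu, Matrix.scalar_apply, ← Matrix.smul_one_eq_diagonal, mul_smul_comm,
        mul_one]
  · rintro ⟨u, κ, hu, hκ, h⟩
    have hd : κ.det ≠ 0 := by
      intro h0
      have := hκ.det_eq
      rw [h0, map_zero] at this
      exact zero_ne_one this
    refine ⟨Matrix.GeneralLinearGroup.mkOfDetNeZero κ hd, (mem_Kinf_iff W _).mpr hκ,
      Matrix.GeneralLinearGroup.scalar (Fin 2) (Units.mk0 u hu), ?_, ?_⟩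
    · rw [Matrix.GeneralLinearGroup.center_eq_range_scalar]
      exact ⟨_, rfl⟩
    · apply Units.ext
      rw [h, Units.val_mul]
      change κ * Matrix.scalar (Fin 2) u = _
      rw [Matrix.scalar_apply, ← Matrix.smul_one_eq_diagonal, mul_smul_comm, mul_one]

lemma vert_eq_iff (g h : Ginf W) : vert W g = vert W h ↔
    ∃ (u : Finf W) (κ : Matrix (Fin 2) (Fin 2) (Finf W)), u ≠ 0 ∧ IsIntegralUnit W κ ∧
      (h : Matrix (Fin 2) (Fin 2) (Finf W)) = u • ((g : Matrix (Fin 2) (Fin 2) (Finf W)) * κ) := by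
  rw [vert, vert, QuotientGroup.eq, mem_KZ_iff]
  refine exists_congr fun u ↦ exists_congr fun κ ↦ and_congr_right fun _ ↦ and_congr_right fun _ ↦ ?_
  constructor
  · intro e
    have : (h : Matrix (Fin 2) (Fin 2) (Finf W)) = (g : Matrix (Fin 2) (Fin 2) (Finf W)) *
      ((g⁻¹ * h : Ginf W) : Matrix (Fin 2) (Fin 2) (Finf W)) := by
      rw [← Units.val_mul, mul_inv_cancel_left]
    rw [this, e, mul_smul_comm]
  · intro e
    rw [Units.val_mul, e, mul_smul_comm, ← mul_assoc, ← Units.val_mul, inv_mul_cancel,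
      Units.val_one, one_mul]

lemma psl_mul {R : Type*} [CommRing R] (a a' : Rˣ) (b b' : R) :
    psl a b * psl a' b' = psl (a * a') (a * b' + b) := by
  ext i j
  fin_cases i <;> fin_cases j <;> simp [coe_psl, Matrix.mul_apply, Fin.sum_univ_two]

lemma psl_inv {R : Type*} [CommRing R] (a : Rˣ) (b : R) :
    (psl a b)⁻¹ = psl a⁻¹ (-((a⁻¹ : Rˣ) : R) * b) := by
  rw [inv_eq_iff_mul_eq_one, psl_mul]
  ext i j
  fin_cases i <;> fin_cases j <;> simp [coe_psl]

lemma psl_mem_KZ_iff (a : (Finf W)ˣ) (b : Finf W) :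
    psl a b ∈ KZ W ↔ vInf W (a : Finf W) = 1 ∧ vInf W b ≤ 1 := by
  rw [mem_KZ_iff]
  constructor
  · rintro ⟨u, κ, hu, hκ, h⟩
    rw [coe_psl] at h
    have h00 : (a : Finf W) = u * κ 0 0 := by simpa using congrFun (congrFun h 0) 0
    have h01 : b = u * κ 0 1 := by simpa using congrFun (congrFun h 0) 1
    have h11 : (1 : Finf W) = u * κ 1 1 := by simpa using congrFun (congrFun h 1) 1
    have hdet : (a : Finf W) = u ^ 2 * κ.det := by
      have := congrArg Matrix.det h
      rwa [Matrix.det_smul, Fintype.card_fin, Matrix.det_fin_two_of, mul_one, mul_zero,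
        sub_zero] at this
    have hva : vInf W (a : Finf W) = vInf W u ^ 2 := by
      rw [hdet, map_mul, hκ.det_eq, mul_one, map_pow]
    have hu0 : vInf W u ≠ 0 := by simpa using hu
    -- The entry 1 = u κ₁₁ gives |u| ≥ 1, while |u|² = |a| = |u κ₀₀| ≤ |u| gives |u| ≤ 1.
    have h1 : 1 ≤ vInf W u := by
      have := congrArg (vInf W) h11
      rw [map_one, map_mul] at this
      rw [this]
      exact (mul_le_mul_right (hκ.entry_le 1 1) _).trans (by rw [mul_one])
    have h2 : vInf W u ≤ 1 := by
      have h3 : vInf W u * vInf W u ≤ vInf W u * 1 := by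
        rw [← sq, ← hva, h00, map_mul]
        exact mul_le_mul_right (hκ.entry_le 0 0) _
      exact (mul_le_mul_iff_right₀ (zero_lt_iff.mpr hu0)).mp h3
    have h3 := le_antisymm h2 h1
    refine ⟨by rw [hva, h3, one_pow], ?_⟩
    rw [h01, map_mul, h3, one_mul]
    exact hκ.entry_le 0 1
  · rintro ⟨ha, hb⟩
    refine ⟨1, _, one_ne_zero, ⟨?_, ?_⟩, (one_smul _ _).symm⟩
    · intro i j
      fin_cases i <;> fin_cases j <;> simp [coe_psl, ha, hb]
    · simpa [coe_psl, Matrix.det_fin_two_of] using ha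

/-- The vertex represented by the matrix with rows `(tⁿ, b)` and `(0, 1)`. -/
def pv (n : ℤ) (b : Finf W) : Vert W := vert W (psl (t W ^ n) b)

lemma coe_t_zpow (n : ℤ) : ((t W ^ n : (Finf W)ˣ) : Finf W) = tInf W ^ n :=
  Units.val_zpow_eq_zpow_val _ _

lemma vert_psl_eq_iff (a a' : (Finf W)ˣ) (b b' : Finf W) :
    vert W (psl a b) = vert W (psl a' b') ↔
      vInf W (a : Finf W) = vInf W (a' : Finf W) ∧ vInf W (b - b') ≤ vInf W (a : Finf W) := by
  have ha : 0 < vInf W (a : Finf W) := zero_lt_iff.mpr (by simp)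
  rw [vert, vert, QuotientGroup.eq, psl_inv, psl_mul, psl_mem_KZ_iff]
  have e : ((a⁻¹ : (Finf W)ˣ) : Finf W) * b' + -((a⁻¹ : (Finf W)ˣ) : Finf W) * b =
    ((a⁻¹ : (Finf W)ˣ) : Finf W) * (b' - b) := by ring
  rw [e, Units.val_mul, map_mul, map_mul, Units.val_inv_eq_inv_val, map_inv₀,
    inv_mul_eq_one₀ ha.ne', inv_mul_le_iff₀ ha, mul_one, Valuation.map_sub_swap]

lemma pv_eq_iff (n m : ℤ) (b b' : Finf W) :
    pv W n b = pv W m b' ↔ n = m ∧ vInf W (b - b') ≤ WithZero.exp (-n) := by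
  rw [pv, pv, vert_psl_eq_iff, coe_t_zpow, coe_t_zpow, vInf_tInf_zpow, vInf_tInf_zpow,
    WithZero.exp_inj, neg_inj]

lemma vert_psl_eq_pv {a : (Finf W)ˣ} {n : ℤ} (ha : vInf W (a : Finf W) = WithZero.exp (-n))
    (b : Finf W) : vert W (psl a b) = pv W n b := by
  rw [pv, vert_psl_eq_iff, ha, coe_t_zpow, vInf_tInf_zpow, sub_self, map_zero]
  exact ⟨rfl, zero_le⟩

/-- Reduction to upper triangular form by column operations. -/
lemma exists_triangular (g : Ginf W) : ∃ (κ : Matrix (Fin 2) (Fin 2) (Finf W)) (a b d : Finf W),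
    IsIntegralUnit W κ ∧ a ≠ 0 ∧ d ≠ 0 ∧
      (g : Matrix (Fin 2) (Fin 2) (Finf W)) * κ = !![a, b; 0, d] := by
  suffices H : ∃ (κ : Matrix (Fin 2) (Fin 2) (Finf W)) (a b d : Finf W),
      IsIntegralUnit W κ ∧ (g : Matrix (Fin 2) (Fin 2) (Finf W)) * κ = !![a, b; 0, d] by
    obtain ⟨κ, a, b, d, hκ, h⟩ := H
    have hdet := congrArg Matrix.det h
    rw [Matrix.det_mul, Matrix.det_fin_two_of, mul_zero, sub_zero] at hdet
    have hne : a * d ≠ 0 := by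
      rw [← hdet]
      refine mul_ne_zero ((Matrix.isUnit_iff_isUnit_det _).mp g.isUnit).ne_zero ?_
      intro h0
      have := hκ.det_eq
      rw [h0, map_zero] at this
      exact zero_ne_one this
    exact ⟨κ, a, b, d, hκ, left_ne_zero_of_mul hne, right_ne_zero_of_mul hne, h⟩
  have hg : (g : Matrix (Fin 2) (Fin 2) (Finf W)).det ≠ 0 :=
    ((Matrix.isUnit_iff_isUnit_det _).mp g.isUnit).ne_zero
  have hg' := Matrix.eta_fin_two (g : Matrix (Fin 2) (Fin 2) (Finf W))
  set p := (g : Matrix (Fin 2) (Fin 2) (Finf W)) 0 0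
  set q := (g : Matrix (Fin 2) (Fin 2) (Finf W)) 0 1
  set r := (g : Matrix (Fin 2) (Fin 2) (Finf W)) 1 0
  set s := (g : Matrix (Fin 2) (Fin 2) (Finf W)) 1 1
  have key : ∀ {r s : Finf W}, s ≠ 0 → vInf W r ≤ vInf W s → vInf W (r / s) ≤ 1 := by
    intro r s hs hrs
    rw [map_div₀]
    exact div_le_one_of_le₀ hrs zero_le
  -- The larger entry of the bottom row is the pivot, so that the quotient used to clear the other
  -- entry is integral.
  rcases le_total (vInf W r) (vInf W s) with h | h
  · have hs : s ≠ 0 := by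
      intro hs
      rw [hs, map_zero, le_zero_iff, Valuation.zero_iff] at h
      apply hg
      rw [hg', Matrix.det_fin_two_of, hs, h]
      ring
    refine ⟨!![1, 0; -(r / s), 1], p - q * (r / s), q, s, ⟨?_, ?_⟩, ?_⟩
    · intro i j
      fin_cases i <;> fin_cases j <;> simp
      simpa using key hs h
    · simp [Matrix.det_fin_two_of]
    · rw [hg']
      ext i j
      fin_cases i <;> fin_cases j <;> simp [Matrix.mul_apply, Fin.sum_univ_two]
      · ring
      · field_simp; ring
  · have hr : r ≠ 0 := by
      intro hr
      rw [hr, map_zero, le_zero_iff, Valuation.zero_iff] at h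
      apply hg
      rw [hg', Matrix.det_fin_two_of, hr, h]
      ring
    refine ⟨!![-(s / r), 1; 1, 0], q - p * (s / r), p, r, ⟨?_, ?_⟩, ?_⟩
    · intro i j
      fin_cases i <;> fin_cases j <;> simp
      simpa using key hr h
    · simp [Matrix.det_fin_two_of]
    · rw [hg']
      ext i j
      fin_cases i <;> fin_cases j <;> simp [Matrix.mul_apply, Fin.sum_univ_two]
      · ring
      · field_simp; ring

lemma vert_eq_psl {g : Ginf W} {κ : Matrix (Fin 2) (Fin 2) (Finf W)} {a b d : Finf W}
    (hκ : IsIntegralUnit W κ) (ha : a ≠ 0) (hd : d ≠ 0)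
    (h : (g : Matrix (Fin 2) (Fin 2) (Finf W)) * κ = !![a, b; 0, d]) :
    vert W g = vert W (psl (Units.mk0 (a / d) (div_ne_zero ha hd)) (b / d)) := by
  rw [vert_eq_iff]
  refine ⟨d⁻¹, κ, inv_ne_zero hd, hκ, ?_⟩
  rw [h, coe_psl]
  simp only [Matrix.smul_of, Matrix.smul_cons, Matrix.smul_empty, smul_eq_mul, mul_zero,
    inv_mul_cancel₀ hd, div_eq_inv_mul, Units.val_mk0]

lemma exists_eq_pv (v : Vert W) : ∃ n b, v = pv W n b := by
  obtain ⟨g, rfl⟩ := QuotientGroup.mk_surjective v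
  obtain ⟨κ, a, b, d, hκ, ha, hd, h⟩ := exists_triangular W g
  have e := vert_eq_psl W hκ ha hd h
  obtain ⟨n, hn⟩ := exists_vInf_eq W (z := a / d) (div_ne_zero ha hd)
  refine ⟨-n, b / d, e.trans (vert_psl_eq_pv W ?_ _)⟩
  rw [neg_neg]
  exact hn

end

/-! ### Neighbours and the Hecke operator -/

section

variable (W : WeierstrassCurve k)

lemma vert_mul_congr (g : Ginf W) {h h' : Ginf W} (e : vert W h = vert W h') :
    vert W (g * h) = vert W (g * h') :=
  congrArg (g • ·) e

lemma vInf_mul_apply_le {m m' : Matrix (Fin 2) (Fin 2) (Finf W)} (h : ∀ i j, vInf W (m i j) ≤ 1)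
    (h' : ∀ i j, vInf W (m' i j) ≤ 1) (i j : Fin 2) : vInf W ((m * m') i j) ≤ 1 := by
  rw [Matrix.mul_apply, Fin.sum_univ_two]
  refine Valuation.map_add_le _ ?_ ?_
  · rw [map_mul]; exact mul_le_one' (h _ _) (h' _ _)
  · rw [map_mul]; exact mul_le_one' (h _ _) (h' _ _)

/-- An integral matrix whose determinant is a uniformizer represents a neighbour of the
standard vertex. -/
lemma vert_of_det_uniformizer {m : Ginf W} (hm : ∀ i j, vInf W (m i j) ≤ 1)
    (hdet : vInf W (m : Matrix (Fin 2) (Fin 2) (Finf W)).det = WithZero.exp (-1)) :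
    (∃ a : k, vert W m = pv W 1 (cst W a)) ∨ vert W m = pv W (-1) 0 := by
  obtain ⟨κ, a, b, d, hκ, ha, hd, h⟩ := exists_triangular W m
  have hle := vInf_mul_apply_le W (m := m) hm hκ.entry_le
  rw [h] at hle
  have ha1 : vInf W a ≤ 1 := by simpa using hle 0 0
  have hb1 : vInf W b ≤ 1 := by simpa using hle 0 1
  have hd1 : vInf W d ≤ 1 := by simpa using hle 1 1
  have had : vInf W a * vInf W d = WithZero.exp (-1) := by
    have := congrArg Matrix.det h
    rw [Matrix.det_mul, Matrix.det_fin_two_of, mul_zero, sub_zero] at this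
    rw [← map_mul, ← this, map_mul, hκ.det_eq, hdet, mul_one]
  have e := vert_eq_psl W hκ ha hd h
  obtain ⟨i, hi⟩ := exists_vInf_eq W ha
  obtain ⟨j, hj⟩ := exists_vInf_eq W hd
  rw [hi, ← WithZero.exp_zero, WithZero.exp_le_exp] at ha1
  rw [hj, ← WithZero.exp_zero, WithZero.exp_le_exp] at hd1
  rw [hi, hj, ← WithZero.exp_add, WithZero.exp_inj] at had
  have hdiv : vInf W (a / d) = WithZero.exp (i - j) := by
    rw [map_div₀, hi, hj, WithZero.exp_sub]
  -- Both exponents are at most 0 and add up to -1, so one diagonal entry is a unit and the other a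
  -- uniformizer.
  obtain rfl | rfl : j = 0 ∨ j = -1 := by omega
  · left
    obtain ⟨c, hc⟩ := exists_cst_approx W (z := b / d) (n := 0) (by
      rw [map_div₀, hj]
      simpa using hb1)
    refine ⟨c, ?_⟩
    rw [e, vert_psl_eq_pv W (n := 1) (by rw [Units.val_mk0, hdiv, WithZero.exp_inj]; omega), pv_eq_iff]
    exact ⟨rfl, by simpa using hc⟩
  · right
    rw [e, vert_psl_eq_pv W (n := -1) (by rw [Units.val_mk0, hdiv, WithZero.exp_inj]; omega), pv_eq_iff]
    refine ⟨rfl, ?_⟩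
    rw [sub_zero, map_div₀, hj, neg_neg, WithZero.exp_neg, div_inv_eq_mul]
    exact (mul_le_mul_left hb1 _).trans (by rw [one_mul])

/-- `Adj` allows any representative of the first vertex. Up to scalars both kinds of neighbour are
integral matrices with uniformizer determinant. That class is stable under left multiplication by
K_∞, so one fixed representative g suffices. -/
lemma adj_iff (g : Ginf W) (w : Vert W) : Adj W (vert W g) w ↔
    (∃ a : k, w = vert W (g * psl (t W ^ (1 : ℤ)) (cst W a))) ∨
      w = vert W (g * psl (t W ^ (-1 : ℤ)) 0) := by
  constructor
  · rintro ⟨g₁, g₂, h1, rfl, h⟩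
    obtain ⟨p, s, m₀, hp, hs, hm₀, hdet, hpm⟩ : ∃ (p : Ginf W) (s : Finf W)
        (m₀ : Matrix (Fin 2) (Fin 2) (Finf W)), vert W (g₁⁻¹ * g₂) = vert W p ∧ s ≠ 0 ∧
        (∀ i j, vInf W (m₀ i j) ≤ 1) ∧ vInf W m₀.det = WithZero.exp (-1) ∧
        (p : Matrix (Fin 2) (Fin 2) (Finf W)) = s • m₀ := by
      have ht1 : vInf W (t W : Finf W) ≤ 1 := by
        rw [← tInf, vInf_tInf, ← WithZero.exp_zero, WithZero.exp_le_exp]; simp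
      rcases h with ⟨b, hb, h⟩ | h
      · refine ⟨_, 1, _, h, one_ne_zero, ?_, ?_, (one_smul _ _).symm⟩
        · have hb : vInf W b ≤ 1 := hb
          intro i j
          fin_cases i <;> fin_cases j <;> simp [coe_psl, hb, ht1]
        · rw [coe_psl, Matrix.det_fin_two_of, mul_one, mul_zero, sub_zero]
          exact vInf_tInf W
      · refine ⟨_, (tInf W)⁻¹, !![1, 0; 0, tInf W], h, inv_ne_zero (tInf_ne_zero W), ?_, ?_, ?_⟩
        · intro i j
          fin_cases i <;> fin_cases j <;> simp
          exact ht1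
        · rw [Matrix.det_fin_two_of, mul_zero, sub_zero, one_mul, vInf_tInf]
        · rw [coe_psl, Matrix.smul_of]
          simp only [Matrix.smul_cons, Matrix.smul_empty, smul_eq_mul, mul_zero, mul_one,
            inv_mul_cancel₀ (tInf_ne_zero W), Units.val_inv_eq_inv_val]
          rfl
    have hg : g⁻¹ * g₁ ∈ KZ W := QuotientGroup.eq.mp h1
    obtain ⟨u, κ, hu, hκ, hgκ⟩ := (mem_KZ_iff W _).mp hg
    have hdet' : vInf W (κ * m₀).det = WithZero.exp (-1) := by
      rw [Matrix.det_mul, map_mul, hκ.det_eq, hdet, one_mul]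
    let M : Ginf W := Matrix.GeneralLinearGroup.mkOfDetNeZero (κ * m₀) (by
      intro h0
      rw [h0, map_zero] at hdet'
      exact WithZero.exp_ne_zero hdet'.symm)
    have hM : vert W (g⁻¹ * g₁ * p) = vert W M := by
      symm
      rw [vert_eq_iff]
      refine ⟨u * s, 1, mul_ne_zero hu hs, ⟨?_, by simp⟩, ?_⟩
      · intro i j
        fin_cases i <;> fin_cases j <;> simp
      · rw [Units.val_mul, hgκ, hpm, mul_one, smul_mul_smul_comm]
        rfl
    have hw : vert W g₂ = vert W (g * M) := by
      rw [← vert_mul_congr W g hM]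
      have := vert_mul_congr W g₁ hp
      rw [mul_inv_cancel_left] at this
      rw [this, mul_assoc, mul_inv_cancel_left]
    rcases vert_of_det_uniformizer W (m := M) (vInf_mul_apply_le W hκ.entry_le hm₀) hdet' with
      ⟨a, ha⟩ | ha
    · exact .inl ⟨a, hw.trans (vert_mul_congr W g ha)⟩
    · exact .inr (hw.trans (vert_mul_congr W g ha))
  · rintro (⟨a, rfl⟩ | rfl)
    · refine ⟨g, _, rfl, rfl, .inl ⟨cst W a, vInf_cst_le W a, ?_⟩⟩
      rw [inv_mul_cancel_left, zpow_one]
    · refine ⟨g, _, rfl, rfl, .inr ?_⟩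
      rw [inv_mul_cancel_left, zpow_neg, zpow_one]

/-- The neighbours of the vertex `pv n b`. -/
def nbr (n : ℤ) (b : Finf W) : Option k → Vert W
  | none => pv W (n - 1) b
  | some a => pv W (n + 1) (b + cst W a * tInf W ^ n)

lemma adj_pv_iff (n : ℤ) (b : Finf W) (w : Vert W) :
    Adj W (pv W n b) w ↔ w ∈ Set.range (nbr W n b) := by
  rw [pv, adj_iff, psl_mul, mul_zero, zero_add, ← zpow_add, ← sub_eq_add_neg]
  simp only [psl_mul, ← zpow_add, coe_t_zpow]
  constructor
  · rintro (⟨a, rfl⟩ | rfl)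
    · exact ⟨some a, by rw [nbr, pv, mul_comm, add_comm b]⟩
    · exact ⟨none, rfl⟩
  · rintro ⟨_ | a, rfl⟩
    · exact .inr rfl
    · exact .inl ⟨a, by rw [nbr, pv, mul_comm, add_comm b]⟩

/-- Ensures that the sum over neighbours in `Phi` has q + 1 distinct terms. -/
lemma nbr_injective (n : ℤ) (b : Finf W) : Function.Injective (nbr W n b) := by
  rintro (_ | a) (_ | a') h
  · rfl
  · have := ((pv_eq_iff W _ _ _ _).mp h).1
    omega
  · have := ((pv_eq_iff W _ _ _ _).mp h).1
    omega
  · have h2 := ((pv_eq_iff W _ _ _ _).mp h).2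
    rw [add_sub_add_left_eq_sub, ← sub_mul, ← map_sub] at h2
    by_contra hne
    have hne' : a - a' ≠ 0 := fun h0 ↦ hne (congrArg some (sub_eq_zero.mp h0))
    rw [vInf_cst_mul_tInf_zpow W hne', WithZero.exp_le_exp] at h2
    omega

lemma Phi_pv [Fintype k] (f : Vert W → ℂ) (n : ℤ) (b : Finf W) :
    Phi W f (pv W n b) = f (pv W (n - 1) b) +
      ∑ a : k, f (pv W (n + 1) (b + cst W a * tInf W ^ n)) := by
  rw [Phi]
  simp only [adj_pv_iff]
  rw [finsum_mem_range (nbr_injective W n b), finsum_eq_sum_of_fintype, Fintype.sum_option]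
  rfl

end

/-! ### Vertices equivalent under `Γ` -/

section

variable (W : WeierstrassCurve k)

/-- Equivalence of vertices under `Γ = GL₂(A)`. -/
def GRel (v w : Vert W) : Prop :=
  ∃ γ : GL (Fin 2) (A W), Matrix.GeneralLinearGroup.map (AtoFinf W) γ • v = w

variable {W}

lemma GRel.of_eq {v w : Vert W} (h : v = w) : GRel W v w := ⟨1, by rw [map_one, one_smul, h]⟩

lemma GRel.symm {v w : Vert W} (h : GRel W v w) : GRel W w v := by
  obtain ⟨γ, rfl⟩ := h
  exact ⟨γ⁻¹, by rw [map_inv, inv_smul_smul]⟩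

lemma GRel.trans {u v w : Vert W} (h : GRel W u v) (h' : GRel W v w) : GRel W u w := by
  obtain ⟨γ, rfl⟩ := h
  obtain ⟨γ', rfl⟩ := h'
  exact ⟨γ' * γ, by rw [map_mul, mul_smul]⟩

lemma IsGamInvariant.eq {f : Vert W → ℂ} (hf : IsGamInvariant W f) {v w : Vert W}
    (h : GRel W v w) : f v = f w := by
  obtain ⟨γ, rfl⟩ := h
  exact (hf _ ⟨γ, rfl⟩ v).symm

lemma Adj.smul {v w : Vert W} (h : Adj W v w) (g : Ginf W) : Adj W (g • v) (g • w) := by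
  obtain ⟨g₁, g₂, rfl, rfl, h⟩ := h
  refine ⟨g * g₁, g * g₂, rfl, rfl, ?_⟩
  rwa [mul_inv_rev, mul_assoc, inv_mul_cancel_left]

variable (W)

lemma map_psl {R S : Type*} [CommRing R] [CommRing S] (φ : R →+* S) (a : Rˣ) (b : R) :
    Matrix.GeneralLinearGroup.map φ (psl a b) = psl (Units.map φ a) (φ b) := by
  ext i j
  rw [Matrix.GeneralLinearGroup.map_apply]
  fin_cases i <;> fin_cases j <;> simp [coe_psl]

/-- The affine matrix with entries a and f acts by b ↦ a b + f. Hence at level n only the class of b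
modulo A + tⁿ𝒪_∞, up to non-zero constants, matters. -/
lemma GRel.pv_affine {n : ℤ} {b b' : Finf W} {a : k} (ha : a ≠ 0) (f : A W)
    (h : vInf W (cst W a * b + AtoFinf W f - b') ≤ WithZero.exp (-n)) :
    GRel W (pv W n b) (pv W n b') := by
  refine ⟨psl (Units.map (algebraMap k (A W)) (Units.mk0 a ha)) f, ?_⟩
  rw [map_psl]
  change vert W (_ * _) = _
  have hv : vInf W ((Units.map (AtoFinf W : A W →* Finf W)
      (Units.map (algebraMap k (A W) : k →* A W) (Units.mk0 a ha)) * t W ^ n : (Finf W)ˣ) :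
      Finf W) = WithZero.exp (-n) := by
    rw [Units.val_mul, coe_t_zpow]
    exact vInf_cst_mul_tInf_zpow W ha n
  rw [psl_mul, vert_psl_eq_pv W (n := n) hv, pv_eq_iff]
  exact ⟨rfl, h⟩

/-- For n < 0 the ball tⁿ𝒪_∞ contains t⁻¹, so together with A it exhausts F_∞. -/
lemma GRel.pv_zero_of_neg {n : ℤ} (hn : n < 0) (b : Finf W) : GRel W (pv W n b) (pv W n 0) := by
  obtain ⟨f, a, h⟩ := exists_decomp W b
  refine GRel.pv_affine W one_ne_zero (-f) ?_
  have e : cst W 1 * b + AtoFinf W (-f) - 0 = (b - AtoFinf W f - cst W a * (tInf W)⁻¹) +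
    cst W a * (tInf W)⁻¹ := by
    rw [map_one, map_neg]; ring
  rw [e]
  refine Valuation.map_add_le _ (h.trans ?_) ?_
  · rw [← WithZero.exp_zero, WithZero.exp_le_exp]; omega
  · rw [map_mul, map_inv₀, vInf_tInf, ← WithZero.exp_neg]
    refine (mul_le_mul_left (vInf_cst_le W _) _).trans ?_
    rw [one_mul, WithZero.exp_le_exp]
    omega

/-- Exchange of the two coordinates, followed by the scalar t⁻ⁿ and the same exchange in K_∞. -/
lemma GRel.pv_neg (n : ℤ) : GRel W (pv W n 0) (pv W (-n) 0) := by
  refine ⟨Matrix.GeneralLinearGroup.mk'' !![0, 1; 1, 0] (by simp [Matrix.det_fin_two_of]), ?_⟩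
  change vert W (_ * _) = _
  rw [pv, vert_eq_iff]
  refine ⟨tInf W ^ (-n), !![0, 1; 1, 0], zpow_ne_zero _ (tInf_ne_zero W), ⟨?_, ?_⟩, ?_⟩
  · intro i j
    fin_cases i <;> fin_cases j <;> simp
  · simp [Matrix.det_fin_two_of]
  · have h1 : (Matrix.GeneralLinearGroup.map (AtoFinf W) (Matrix.GeneralLinearGroup.mk''
        !![0, 1; 1, 0] (by simp [Matrix.det_fin_two_of])) : Matrix (Fin 2) (Fin 2) (Finf W)) =
        !![0, 1; 1, 0] := by
      ext i j
      rw [Matrix.GeneralLinearGroup.map_apply]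
      change AtoFinf W (!![0, 1; 1, 0] i j) = _
      fin_cases i <;> fin_cases j <;> simp
    rw [Units.val_mul, h1, coe_psl, coe_psl, coe_t_zpow, coe_t_zpow, Matrix.mul_fin_two,
      Matrix.mul_fin_two, Matrix.smul_of]
    simp only [Matrix.smul_cons, Matrix.smul_empty, smul_eq_mul, mul_zero, mul_one, zero_mul,
      one_mul, add_zero, zero_add]
    rw [← zpow_add₀ (tInf_ne_zero W), neg_add_cancel, zpow_zero]

lemma vInf_div_sub_inv (l e : k) :
    vInf W ((yInf W + cst W e) / (xInf W - cst W l) - (tInf W)⁻¹) ≤ WithZero.exp (-1) := by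
  have h : (yInf W + cst W e) / (xInf W - cst W l) - (tInf W)⁻¹ =
      (yInf W / (xInf W - cst W l) - ((tInf W)⁻¹ + cst W l * tInf W)) + cst W l * tInf W +
        cst W e * (xInf W - cst W l)⁻¹ := by
    rw [add_div]; ring
  rw [h]
  refine Valuation.map_add_le _ (Valuation.map_add_le _ ((vInf_div_expansion W l).trans ?_) ?_) ?_
  · rw [WithZero.exp_le_exp]; simp
  · rw [map_mul, vInf_tInf]
    exact (mul_le_mul_left (vInf_cst_le W _) _).trans (by rw [one_mul])
  · rw [map_mul, map_inv₀, vInf_xInf_sub_cst, ← WithZero.exp_neg]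
    refine (mul_le_mul_left (vInf_cst_le W _) _).trans ?_
    rw [one_mul, WithZero.exp_le_exp]
    simp

lemma curve_eqn_A : yA W ^ 2 + algebraMap k (A W) W.a₁ * xA W * yA W +
    algebraMap k (A W) W.a₃ * yA W = xA W ^ 3 + algebraMap k (A W) W.a₂ * xA W ^ 2 +
      algebraMap k (A W) W.a₄ * xA W + algebraMap k (A W) W.a₆ := by
  apply AtoFinf_injective W
  simpa [xInf, yInf, cst_apply] using curve_eqn W

/-- If the curve has no affine rational point, then the neighbours of `t_l` other than `z_1`
are equivalent to `z_1`. -/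
lemma GRel.pv_three (hN : ∀ x y : k, ¬ W.toAffine.Equation x y) (l b : k) :
    GRel W (pv W 3 ((tInf W)⁻¹ + cst W l * tInf W + cst W b * tInf W ^ 2))
      (pv W 1 (tInf W)⁻¹) := by
  obtain ⟨e, he⟩ := exists_div_approx W l b
  have hl := xInf_sub_cst_ne_zero W l
  -- The value of the Weierstrass equation at (l, e), non-zero because there is no affine rational
  -- point. P and Q below are its difference quotients: the equation minus its value at (l, e) is P
  -- (y - e) + Q (x - l).
  set E : k := e ^ 2 + W.a₁ * l * e + W.a₃ * e - (l ^ 3 + W.a₂ * l ^ 2 + W.a₄ * l + W.a₆) with hE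
  have hE0 : E ≠ 0 := fun h ↦ hN l e ((WeierstrassCurve.Affine.equation_iff' _ _).mpr h)
  set ι := algebraMap k (A W) with hι
  set P : A W := yA W + ι e + ι W.a₁ * xA W + ι W.a₃ with hP
  set Q : A W := ι W.a₁ * ι e - (xA W ^ 2 + xA W * ι l + ι l ^ 2) - ι W.a₂ * (xA W + ι l) -
    ι W.a₄ with hQ
  have hPQ : P * (yA W - ι e) + Q * (xA W - ι l) = -ι E := by
    have := curve_eqn_A W
    rw [hP, hQ, hE]
    simp only [map_sub, map_add, map_mul, map_pow]
    linear_combination this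
  have hdet : (!![P, Q; xA W - ι l, -(yA W - ι e)]).det = ι E := by
    rw [Matrix.det_fin_two_of]
    linear_combination -hPQ
  have hunit : IsUnit (!![P, Q; xA W - ι l, -(yA W - ι e)]).det := by
    rw [hdet]
    exact (isUnit_iff_ne_zero.mpr hE0).map ι
  set s : Finf W := (yInf W - cst W e) / (xInf W - cst W l) with hs
  have h1 : pv W 3 ((tInf W)⁻¹ + cst W l * tInf W + cst W b * tInf W ^ 2) = pv W 3 s := by
    rw [pv_eq_iff]
    exact ⟨rfl, by rwa [Valuation.map_sub_swap]⟩
  rw [h1]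
  set P' : Finf W := yInf W + cst W e + cst W W.a₁ * xInf W + cst W W.a₃ with hP'
  set Q' : Finf W := AtoFinf W Q with hQ'
  have hPQ' : P' * (yInf W - cst W e) + Q' * (xInf W - cst W l) = -cst W E := by
    have := congrArg (AtoFinf W) hPQ
    simp only [map_add, map_mul, map_sub, map_neg] at this
    rw [← hQ', hP] at this
    simp only [map_add, map_mul] at this
    exact this
  let γ : GL (Fin 2) (A W) := Matrix.GeneralLinearGroup.mk'' _ hunit
  have hγ : ((Matrix.GeneralLinearGroup.map (AtoFinf W) γ : Ginf W) :
      Matrix (Fin 2) (Fin 2) (Finf W)) =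
      !![P', Q'; xInf W - cst W l, -(yInf W - cst W e)] := by
    ext i j
    rw [Matrix.GeneralLinearGroup.map_apply]
    change AtoFinf W (!![P, Q; xA W - ι l, -(yA W - ι e)] i j) = _
    fin_cases i <;> fin_cases j <;> simp [hP, hP', xInf, yInf, cst_apply, hQ', hι]
  have ht := tInf_ne_zero W
  have hd : (xInf W - cst W l) * tInf W ^ (3 : ℤ) ≠ 0 := mul_ne_zero hl (zpow_ne_zero _ ht)
  have ha : -cst W E / (xInf W - cst W l) ≠ 0 :=
    div_ne_zero (neg_ne_zero.mpr ((_root_.map_ne_zero _).mpr hE0)) hl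
  have hκ : IsIntegralUnit W !![0, 1; 1, 0] :=
    ⟨fun i j ↦ by fin_cases i <;> fin_cases j <;> simp, by simp [Matrix.det_fin_two_of]⟩
  -- The bottom row of γ kills the vector (s, 1), so after exchanging columns the product is upper
  -- triangular. The quotient of its diagonal entries has order 2 + 2 - 3 = 1, which is the new
  -- level.
  have hmul : ((Matrix.GeneralLinearGroup.map (AtoFinf W) γ * psl (t W ^ (3 : ℤ)) s : Ginf W) :
      Matrix (Fin 2) (Fin 2) (Finf W)) * !![0, 1; 1, 0] =
      !![-cst W E / (xInf W - cst W l), P' * tInf W ^ (3 : ℤ);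
        0, (xInf W - cst W l) * tInf W ^ (3 : ℤ)] := by
    rw [Units.val_mul, hγ, coe_psl, coe_t_zpow, Matrix.mul_fin_two, Matrix.mul_fin_two, ← hPQ', hs]
    ext i j
    fin_cases i <;> fin_cases j
    · simp only [Fin.zero_eta, Matrix.of_apply, Matrix.cons_val_zero]
      field_simp
      ring
    · simp
    · simp only [Fin.mk_one, Fin.zero_eta, Matrix.of_apply, Matrix.cons_val_one,
        Matrix.cons_val_zero]
      field_simp
      ring
    · simp
  have h2 := vert_eq_psl W hκ ha hd hmul
  refine GRel.trans (v := pv W 1 (P' / (xInf W - cst W l))) ⟨γ, ?_⟩ ?_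
  · refine h2.trans ?_
    rw [vert_psl_eq_pv W (n := 1), mul_div_mul_right _ _ (zpow_ne_zero _ ht)]
    rw [Units.val_mk0, map_div₀, map_div₀, Valuation.map_neg, vInf_cst W hE0, map_mul,
      vInf_xInf_sub_cst, vInf_tInf_zpow, ← WithZero.exp_add, ← WithZero.exp_zero,
      ← WithZero.exp_sub, ← WithZero.exp_sub]
    rfl
  · refine GRel.pv_affine W one_ne_zero (-ι W.a₁) ?_
    have e : cst W 1 * (P' / (xInf W - cst W l)) + AtoFinf W (-ι W.a₁) - (tInf W)⁻¹ =
        (yInf W + cst W (e + W.a₃ + W.a₁ * l)) / (xInf W - cst W l) - (tInf W)⁻¹ := by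
      rw [map_neg, hι, ← cst_apply, hP']
      simp only [map_one, map_add, map_mul]
      field_simp
      ring
    rw [e]
    exact vInf_div_sub_inv W l _

end

/-! ### Vertices and edges of the quotient graph -/

section

variable (W : WeierstrassCurve k)

lemma c_eq (n : ℕ) : c W n = pv W (-n) 0 := by
  rw [c, pv]
  congr 2
  simp

lemma z0_eq : z0 W = pv W 0 (tInf W)⁻¹ := by
  rw [z0, pv, zpow_zero, Units.val_inv_eq_inv_val]
  rfl

lemma z1_eq : z1 W = pv W 1 (tInf W)⁻¹ := by
  rw [z1, pv, zpow_one, Units.val_inv_eq_inv_val]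
  rfl

lemma tv_eq (l : k) : tv W l = pv W 2 ((tInf W)⁻¹ + cst W l * tInf W) := by
  rw [tv, pv, Units.val_inv_eq_inv_val]
  rfl

lemma pv_neg_rel_c (n : ℕ) (b : Finf W) : GRel W (pv W (-(n + 1 : ℕ)) b) (c W (n + 1)) := by
  rw [c_eq]
  exact GRel.pv_zero_of_neg W (by push_cast; omega) b

lemma pv_one_const_rel (a : k) : GRel W (pv W 1 (cst W a)) (c W 1) := by
  rw [c_eq]
  refine GRel.trans (v := pv W 1 0) ?_ (GRel.pv_neg W 1)
  refine GRel.pv_affine W one_ne_zero (-algebraMap k (A W) a) ?_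
  rw [map_one, one_mul, map_neg, ← cst_apply, add_neg_cancel, sub_zero, map_zero]
  exact zero_le

lemma pv_zero_rel_z0 {a : k} (ha : a ≠ 0) : GRel W (pv W 0 (cst W a * (tInf W)⁻¹)) (z0 W) := by
  rw [z0_eq]
  refine GRel.pv_affine W (inv_ne_zero ha) 0 ?_
  rw [← mul_assoc, ← map_mul, inv_mul_cancel₀ ha, map_one, one_mul, map_zero, add_zero, sub_self,
    map_zero]
  exact zero_le

lemma pv_one_rel_z1 (a : k) : GRel W (pv W 1 ((tInf W)⁻¹ + cst W a)) (z1 W) := by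
  rw [z1_eq]
  refine GRel.pv_affine W one_ne_zero (-algebraMap k (A W) a) ?_
  rw [map_one, one_mul, map_neg, ← cst_apply, add_neg_cancel_right, sub_self, map_zero]
  exact zero_le

lemma pv_one_eq_z1 (l : k) : pv W 1 ((tInf W)⁻¹ + cst W l * tInf W) = z1 W := by
  rw [z1_eq, pv_eq_iff]
  refine ⟨rfl, ?_⟩
  rw [add_sub_cancel_left, map_mul, vInf_tInf]
  exact (mul_le_mul_left (vInf_cst_le W _) _).trans (by rw [one_mul])

lemma pv_zero_rel (b : Finf W) : GRel W (pv W 0 b) (c W 0) ∨ GRel W (pv W 0 b) (z0 W) := by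
  obtain ⟨f, a, h⟩ := exists_decomp W b
  have h1 : GRel W (pv W 0 b) (pv W 0 (cst W a * (tInf W)⁻¹)) := by
    refine GRel.pv_affine W one_ne_zero (-f) ?_
    rw [map_one, one_mul, map_neg, ← sub_eq_add_neg]
    simpa using h
  by_cases ha : a = 0
  · left
    rw [c_eq]
    simpa [ha] using h1
  · exact .inr (h1.trans (pv_zero_rel_z0 W ha))

variable {W}

lemma nbr_c_zero (o : Option k) : GRel W (nbr W 0 0 o) (c W 1) := by
  rcases o with _ | a
  · exact pv_neg_rel_c W 0 0
  · have := pv_one_const_rel W a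
    simpa [nbr] using this

lemma nbr_c_one [DecidableEq k] (a : k) :
    GRel W (nbr W (-1) 0 (some a)) (if a = 0 then c W 0 else z0 W) := by
  split_ifs with ha
  · refine GRel.of_eq ?_
    rw [c_eq]
    simp [nbr, ha]
  · have := pv_zero_rel_z0 W ha
    simpa [nbr] using this

lemma nbr_c_add_two (n : ℕ) (a : k) :
    GRel W (nbr W (-(n + 2 : ℕ)) 0 (some a)) (c W (n + 1)) := by
  have := pv_neg_rel_c W n (0 + cst W a * tInf W ^ (-(n + 2 : ℕ) : ℤ))
  rw [nbr]
  convert this using 2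
  push_cast
  ring

lemma nbr_c_none (n : ℕ) : nbr W (-n) 0 none = c W (n + 1) := by
  rw [c_eq, nbr]
  congr 1
  push_cast
  ring

lemma nbr_z0_none : GRel W (nbr W 0 (tInf W)⁻¹ none) (c W 1) :=
  pv_neg_rel_c W 0 _

lemma nbr_z0_some (a : k) : GRel W (nbr W 0 (tInf W)⁻¹ (some a)) (z1 W) := by
  have := pv_one_rel_z1 W a
  simpa [nbr] using this

lemma nbr_z1_none : nbr W 1 (tInf W)⁻¹ none = z0 W := by
  rw [z0_eq]
  rfl

lemma nbr_z1_some (a : k) : nbr W 1 (tInf W)⁻¹ (some a) = tv W a := by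
  rw [tv_eq, nbr, zpow_one]
  rfl

lemma nbr_tv_none (l : k) : nbr W 2 ((tInf W)⁻¹ + cst W l * tInf W) none = z1 W :=
  pv_one_eq_z1 W l

lemma nbr_tv_some (hN : ∀ x y : k, ¬ W.toAffine.Equation x y) (l a : k) :
    GRel W (nbr W 2 ((tInf W)⁻¹ + cst W l * tInf W) (some a)) (z1 W) := by
  rw [z1_eq]
  have := GRel.pv_three W hN l a
  rw [nbr]
  convert this using 2
  · norm_num
  · rw [zpow_ofNat]

variable (k) in
/-- The vertices of the quotient graph. -/
inductive QuotVertex : Type _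
  | c (n : ℕ)
  | z0
  | z1
  | t (l : k)

variable (W) in
/-- The chosen representatives of the vertices of the quotient graph. -/
def rep : QuotVertex k → Vert W
  | .c n => EllTree.c W n
  | .z0 => EllTree.z0 W
  | .z1 => EllTree.z1 W
  | .t l => tv W l

/-- The list of representatives is closed under passing to neighbours, up to Γ. Only the neighbours
of the t_l require the absence of rational points. -/
lemma exists_rep_of_adj (hN : ∀ x y : k, ¬ W.toAffine.Equation x y) (i : QuotVertex k)
    {w : Vert W} (h : Adj W (rep W i) w) : ∃ j, GRel W w (rep W j) := by
  rcases i with n | _ | _ | l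
  · change Adj W (c W n) w at h
    rw [c_eq, adj_pv_iff] at h
    obtain ⟨o, rfl⟩ := h
    rcases o with _ | a
    · exact ⟨.c (n + 1), .of_eq (nbr_c_none n)⟩
    rcases n with _ | _ | n
    · refine ⟨.c 1, ?_⟩
      change GRel W _ (c W 1)
      simpa using nbr_c_zero (W := W) (some a)
    · classical
      by_cases ha : a = 0
      · refine ⟨.c 0, ?_⟩
        change GRel W _ (c W 0)
        simpa [ha] using nbr_c_one (W := W) a
      · refine ⟨.z0, ?_⟩
        change GRel W _ (z0 W)
        simpa [ha] using nbr_c_one (W := W) a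
    · exact ⟨.c (n + 1), nbr_c_add_two n a⟩
  · change Adj W (z0 W) w at h
    rw [z0_eq, adj_pv_iff] at h
    obtain ⟨_ | a, rfl⟩ := h
    · exact ⟨.c 1, nbr_z0_none⟩
    · exact ⟨.z1, nbr_z0_some a⟩
  · change Adj W (z1 W) w at h
    rw [z1_eq, adj_pv_iff] at h
    obtain ⟨_ | a, rfl⟩ := h
    · exact ⟨.z0, .of_eq nbr_z1_none⟩
    · exact ⟨.t a, .of_eq (nbr_z1_some a)⟩
  · change Adj W (tv W l) w at h
    rw [tv_eq, adj_pv_iff] at h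
    obtain ⟨_ | a, rfl⟩ := h
    · exact ⟨.z1, .of_eq (nbr_tv_none l)⟩
    · exact ⟨.z1, nbr_tv_some hN l a⟩

/-- Levels at most 0 are covered directly by the decomposition of F_∞. A vertex of level m + 1 is
adjacent to one of level m, so induction and closure under neighbours give the rest. -/
lemma exists_rep (hN : ∀ x y : k, ¬ W.toAffine.Equation x y) (v : Vert W) :
    ∃ i, GRel W v (rep W i) := by
  obtain ⟨n, b, rfl⟩ := exists_eq_pv W v
  rcases lt_or_ge n 0 with hn | hn
  · obtain ⟨m, rfl⟩ : ∃ m : ℕ, n = -(m + 1 : ℕ) := ⟨(-n - 1).toNat, by push_cast; omega⟩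
    exact ⟨.c (m + 1), pv_neg_rel_c W m b⟩
  obtain ⟨m, rfl⟩ := Int.eq_ofNat_of_zero_le hn
  clear hn
  induction m with
  | zero =>
    rcases pv_zero_rel W b with h | h
    · exact ⟨.c 0, h⟩
    · exact ⟨.z0, h⟩
  | succ m ih =>
    obtain ⟨i, γ, hγ⟩ := ih
    have hadj : Adj W (pv W m b) (pv W (m + 1 : ℕ) b) := by
      rw [adj_pv_iff]
      exact ⟨some 0, by simp [nbr]⟩
    have h2 := hadj.smul (Matrix.GeneralLinearGroup.map (AtoFinf W) γ)
    rw [hγ] at h2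
    obtain ⟨j, hj⟩ := exists_rep_of_adj hN i h2
    exact ⟨j, GRel.trans ⟨γ, rfl⟩ hj⟩

section Hecke

variable [Fintype k] {f : Vert W → ℂ}

lemma Phi_c_zero (hf : IsGamInvariant W f) : Phi W f (c W 0) = (Fintype.card k + 1) * f (c W 1) := by
  rw [c_eq, Nat.cast_zero, neg_zero, Phi_pv]
  have h0 := hf.eq (nbr_c_zero (W := W) none)
  have h1 : ∀ a, f (nbr W 0 0 (some a)) = f (c W 1) := fun a ↦ hf.eq (nbr_c_zero _)
  simp only [nbr] at h0 h1
  rw [h0, Finset.sum_congr rfl fun a _ ↦ h1 a, Finset.sum_const, Finset.card_univ, nsmul_eq_mul]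
  ring

/-- The inner neighbours of c_1 are given by a t⁻¹ at level 0. The value a = 0 gives c_0, and the q
- 1 non-zero values all give z_0, since constants can be scaled away. -/
lemma Phi_c_one (hf : IsGamInvariant W f) :
    Phi W f (c W 1) = f (c W 2) + f (c W 0) + (Fintype.card k - 1) * f (z0 W) := by
  classical
  rw [c_eq W 1, Nat.cast_one, Phi_pv]
  have h0 := congrArg f (nbr_c_none (W := W) 1)
  have h1 : ∀ a, f (nbr W (-1) 0 (some a)) = f (z0 W) + if a = 0 then f (c W 0) - f (z0 W) else 0 := by
    intro a
    rw [hf.eq (nbr_c_one a)]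
    split_ifs <;> ring
  simp only [nbr, Nat.cast_one] at h0 h1
  rw [h0, Finset.sum_congr rfl fun a _ ↦ h1 a, Finset.sum_add_distrib, Finset.sum_const,
    Finset.card_univ, nsmul_eq_mul, Finset.sum_ite_eq' Finset.univ]
  simp only [Finset.mem_univ, if_true]
  ring

lemma Phi_c_add_two (hf : IsGamInvariant W f) (n : ℕ) :
    Phi W f (c W (n + 2)) = f (c W (n + 3)) + Fintype.card k * f (c W (n + 1)) := by
  rw [c_eq W (n + 2), Phi_pv]
  have h0 := congrArg f (nbr_c_none (W := W) (n + 2))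
  have h1 : ∀ a, f (nbr W (-(n + 2 : ℕ)) 0 (some a)) = f (c W (n + 1)) :=
    fun a ↦ hf.eq (nbr_c_add_two n a)
  simp only [nbr] at h0 h1
  rw [h0, Finset.sum_congr rfl fun a _ ↦ h1 a, Finset.sum_const, Finset.card_univ, nsmul_eq_mul]

lemma Phi_z0 (hf : IsGamInvariant W f) : Phi W f (z0 W) = f (c W 1) + Fintype.card k * f (z1 W) := by
  rw [z0_eq, Phi_pv]
  have h0 := hf.eq (nbr_z0_none (W := W))
  have h1 : ∀ a, f (nbr W 0 (tInf W)⁻¹ (some a)) = f (z1 W) := fun a ↦ hf.eq (nbr_z0_some a)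
  simp only [nbr] at h0 h1
  rw [h0, Finset.sum_congr rfl fun a _ ↦ h1 a, Finset.sum_const, Finset.card_univ, nsmul_eq_mul]

lemma Phi_z1 (f : Vert W → ℂ) : Phi W f (z1 W) = f (z0 W) + ∑ l : k, f (tv W l) := by
  rw [z1_eq, Phi_pv]
  have h0 := congrArg f (nbr_z1_none (W := W))
  have h1 := fun a ↦ congrArg f (nbr_z1_some (W := W) a)
  simp only [nbr] at h0 h1
  rw [h0, Finset.sum_congr rfl fun a _ ↦ h1 a]

lemma Phi_tv (hf : IsGamInvariant W f) (hN : ∀ x y : k, ¬ W.toAffine.Equation x y)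
    (l : k) :
    Phi W f (tv W l) = (Fintype.card k + 1) * f (z1 W) := by
  rw [tv_eq, Phi_pv]
  have h0 := congrArg f (nbr_tv_none (W := W) l)
  have h1 : ∀ a, f (nbr W 2 ((tInf W)⁻¹ + cst W l * tInf W) (some a)) = f (z1 W) :=
    fun a ↦ hf.eq (nbr_tv_some hN l a)
  simp only [nbr] at h0 h1
  rw [h0, Finset.sum_congr rfl fun a _ ↦ h1 a, Finset.sum_const, Finset.card_univ, nsmul_eq_mul]
  ring

end Hecke

end

/-! ### The representatives are inequivalent -/

section

variable (W : WeierstrassCurve k)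

/-- The vector `(x, y) ∈ A²` has norm at most `exp j` with respect to the lattice that
corresponds to the vertex `pv n b`. -/
def IsShort (n : ℤ) (b : Finf W) (j : ℤ) (x y : A W) : Prop :=
  vInf W (AtoFinf W x - b * AtoFinf W y) ≤ WithZero.exp (j - n) ∧
    vInf W (AtoFinf W y) ≤ WithZero.exp j

variable {W}

lemma valA_eq_one_of_isUnit {f : A W} (hf : IsUnit f) : valA W f = 1 := by
  obtain ⟨g, hg⟩ := hf.exists_right_inv
  have hf0 : f ≠ 0 := hf.ne_zero
  have hg0 : g ≠ 0 := by rintro rfl; simp at hg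
  have h : valA W f * valA W g = 1 := by rw [← map_mul, hg, map_one]
  refine le_antisymm ?_ (one_le_valA W hf0)
  calc valA W f ≤ valA W f * valA W g := le_mul_of_one_le_right' (one_le_valA W hg0)
    _ = 1 := h

/-- Write γ g = u g' κ with g, g' the matrices of the two vertices. Then κ preserves the norm of
coordinate vectors and u rescales it by exp i; comparing determinants gives the change of level 2i.
In particular 2j - n is invariant. -/
lemma isShort_smul {γ : GL (Fin 2) (A W)} {n m : ℤ} {b b' : Finf W}
    (h : Matrix.GeneralLinearGroup.map (AtoFinf W) γ • pv W n b = pv W m b') :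
    ∃ i : ℤ, m = n + 2 * i ∧ ∀ j x y, IsShort W n b j x y →
      IsShort W m b' (j + i) (γ 0 0 * x + γ 0 1 * y) (γ 1 0 * x + γ 1 1 * y) := by
  change vert W (_ * _) = vert W _ at h
  obtain ⟨u, κ, hu, hκ, e⟩ := (vert_eq_iff W _ _).mp h.symm
  obtain ⟨i, hi⟩ := exists_vInf_eq W hu
  have ht := tInf_ne_zero W
  rw [Units.val_mul, coe_psl, coe_psl, coe_t_zpow, coe_t_zpow] at e
  set g := ((Matrix.GeneralLinearGroup.map (AtoFinf W) γ : Ginf W) :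
    Matrix (Fin 2) (Fin 2) (Finf W)) with hg
  have hgij : ∀ i j, g i j = AtoFinf W (γ i j) := fun i j ↦ rfl
  have hgdet : vInf W g.det = 1 := by
    have h1 : g.det = AtoFinf W (γ : Matrix (Fin 2) (Fin 2) (A W)).det :=
      (RingHom.map_det (AtoFinf W) _).symm
    rw [h1, vInf_AtoFinf]
    exact valA_eq_one_of_isUnit ((Matrix.isUnit_iff_isUnit_det _).mp γ.isUnit)
  have hnm : m = n + 2 * i := by
    have := congrArg (fun M ↦ vInf W (Matrix.det M)) e
    simp only [Matrix.det_mul, Matrix.det_smul, Fintype.card_fin, Matrix.det_fin_two_of, map_mul,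
      map_pow, hgdet, hκ.det_eq, hi, mul_one, mul_zero, sub_zero, vInf_tInf_zpow, one_mul] at this
    rw [← WithZero.exp_nsmul, ← WithZero.exp_add, WithZero.exp_inj] at this
    simp only [nsmul_eq_mul, Nat.cast_ofNat] at this
    omega
  refine ⟨i, hnm, fun j x y hxy ↦ ?_⟩
  -- The pair (ξ, y) consists of the coordinates of (x, y) in the basis formed by the columns of g.
  set ξ : Finf W := (AtoFinf W x - b * AtoFinf W y) * tInf W ^ (-n) with hξ
  have hξ' : tInf W ^ n * ξ = AtoFinf W x - b * AtoFinf W y := by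
    rw [hξ, mul_left_comm, ← zpow_add₀ ht, add_neg_cancel, zpow_zero, mul_one]
  have hξv : vInf W ξ ≤ WithZero.exp j := by
    rw [hξ, map_mul, vInf_tInf_zpow]
    refine (mul_le_mul_left hxy.1 _).trans ?_
    rw [← WithZero.exp_add, WithZero.exp_le_exp]
    omega
  have e00 : g 0 0 * tInf W ^ n = u * (tInf W ^ m * κ 0 0 + b' * κ 1 0) := by
    simpa [Matrix.mul_apply, Fin.sum_univ_two, Matrix.vecMul, dotProduct] using
      congrFun (congrFun e 0) 0
  have e01 : g 0 0 * b + g 0 1 = u * (tInf W ^ m * κ 0 1 + b' * κ 1 1) := by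
    simpa [Matrix.mul_apply, Fin.sum_univ_two, Matrix.vecMul, dotProduct] using
      congrFun (congrFun e 0) 1
  have e10 : g 1 0 * tInf W ^ n = u * κ 1 0 := by
    simpa [Matrix.mul_apply, Fin.sum_univ_two, Matrix.vecMul, dotProduct] using
      congrFun (congrFun e 1) 0
  have e11 : g 1 0 * b + g 1 1 = u * κ 1 1 := by
    simpa [Matrix.mul_apply, Fin.sum_univ_two, Matrix.vecMul, dotProduct] using
      congrFun (congrFun e 1) 1
  have hη : ∀ r : Fin 2, vInf W (κ r 0 * ξ + κ r 1 * AtoFinf W y) ≤ WithZero.exp j := by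
    intro r
    refine Valuation.map_add_le _ ?_ ?_
    · rw [map_mul]
      exact (mul_le_mul' (hκ.entry_le _ _) hξv).trans (by rw [one_mul])
    · rw [map_mul]
      exact (mul_le_mul' (hκ.entry_le _ _) hxy.2).trans (by rw [one_mul])
  have h1 : AtoFinf W (γ 1 0 * x + γ 1 1 * y) = u * (κ 1 0 * ξ + κ 1 1 * AtoFinf W y) := by
    rw [map_add, map_mul, map_mul, ← hgij, ← hgij]
    linear_combination (-g 1 0) * hξ' + ξ * e10 + AtoFinf W y * e11
  have h0 : AtoFinf W (γ 0 0 * x + γ 0 1 * y) - b' * AtoFinf W (γ 1 0 * x + γ 1 1 * y) =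
      u * tInf W ^ m * (κ 0 0 * ξ + κ 0 1 * AtoFinf W y) := by
    rw [h1, map_add, map_mul, map_mul, ← hgij, ← hgij]
    linear_combination (-g 0 0) * hξ' + ξ * e00 + AtoFinf W y * e01
  constructor
  · rw [h0, map_mul, map_mul, hi, vInf_tInf_zpow]
    refine (mul_le_mul_right (hη 0) _).trans ?_
    rw [← WithZero.exp_add, ← WithZero.exp_add, WithZero.exp_le_exp]
    omega
  · rw [h1, map_mul, hi]
    refine (mul_le_mul_right (hη 1) _).trans ?_
    rw [← WithZero.exp_add, WithZero.exp_le_exp]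
    omega

lemma IsShort.nonneg {n j : ℤ} {b : Finf W} {x y : A W} (h : IsShort W n b j x y) (hy : y ≠ 0) :
    0 ≤ j := by
  have h1 := (one_le_valA W hy).trans (vInf_AtoFinf W y ▸ h.2)
  rwa [← WithZero.exp_zero, WithZero.exp_le_exp] at h1

lemma IsShort.le {n j : ℤ} {b : Finf W} {x : A W} (h : IsShort W n b j x 0) (hx : x ≠ 0) :
    n ≤ j := by
  have h1 := h.1
  rw [map_zero, mul_zero, sub_zero, vInf_AtoFinf] at h1
  have h2 := (one_le_valA W hx).trans h1
  rw [← WithZero.exp_zero, WithZero.exp_le_exp] at h2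
  omega

/-- By the gap, j ≤ 1 makes y a constant a. Then a t⁻¹ agrees with an element of A up to 𝒪_∞, so a =
0. -/
lemma IsShort.eq_zero {n j : ℤ} {b : Finf W} (hb : vInf W (b - (tInf W)⁻¹) ≤ 1) {x y : A W}
    (h : IsShort W n b j x y) (hj : j ≤ n) (hj1 : j ≤ 1) : y = 0 := by
  have hy : valA W y ≤ 1 := by
    have h1 : valA W y < WithZero.exp 1 := by
      refine lt_of_le_of_ne ?_ (valA_ne_exp_one W y)
      rw [← vInf_AtoFinf]
      exact h.2.trans (by rwa [WithZero.exp_le_exp])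
    simpa using lt_exp_iff_le.mp h1
  obtain ⟨a, rfl⟩ := eq_const_of_valA_le W hy
  have ha : a = 0 := by
    refine eq_zero_of_decomp W (f := x) ?_
    have e : cst W a * (tInf W)⁻¹ - AtoFinf W x =
        -((AtoFinf W x - b * AtoFinf W (algebraMap k (A W) a)) + cst W a * (b - (tInf W)⁻¹)) := by
      rw [cst_apply]; ring
    rw [e, Valuation.map_neg]
    refine Valuation.map_add_le _ (h.1.trans ?_) ?_
    · rw [← WithZero.exp_zero, WithZero.exp_le_exp]; omega
    · rw [map_mul]
      exact mul_le_one' (vInf_cst_le W a) hb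
  rw [ha, map_zero]

variable (W) in
/-- The upper left exponent of the chosen representatives. -/
def repN : QuotVertex k → ℤ
  | .c n => -n
  | .z0 => 0
  | .z1 => 1
  | .t _ => 2

variable (W) in
/-- The upper right entry of the chosen representatives. -/
def repB : QuotVertex k → Finf W
  | .c _ => 0
  | .z0 => (tInf W)⁻¹
  | .z1 => (tInf W)⁻¹
  | .t l => (tInf W)⁻¹ + cst W l * tInf W

lemma rep_eq_pv (i : QuotVertex k) : rep W i = pv W (repN i) (repB W i) := by
  rcases i with n | _ | _ | l
  · exact c_eq W n
  · exact z0_eq W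
  · exact z1_eq W
  · exact tv_eq W l

/-- The representatives that are given by unipotent matrices with a pole. -/
lemma repB_sub_le (i : QuotVertex k) (hi : ∀ n, i ≠ .c n) :
    vInf W (repB W i - (tInf W)⁻¹) ≤ 1 := by
  rcases i with n | _ | _ | l
  · exact absurd rfl (hi n)
  · simp [repB]
  · simp [repB]
  · rw [repB, add_sub_cancel_left, map_mul, vInf_tInf]
    refine mul_le_one' (vInf_cst_le W l) ?_
    rw [← WithZero.exp_zero, WithZero.exp_le_exp]
    simp

/-- For a representative of level n, a non-zero vector is short only for j ≥ n, with equality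
attained by (1, 0). The bound is phrased with 2j - n because this is the quantity preserved by Γ;
its minimum is n. -/
lemma repN_le_of_isShort {i : QuotVertex k} {j : ℤ} {x y : A W} (hxy : x ≠ 0 ∨ y ≠ 0)
    (h : IsShort W (repN i) (repB W i) j x y) : repN i ≤ 2 * j - repN i := by
  by_cases hy : y = 0
  · subst hy
    have := h.le (by simpa using hxy)
    omega
  have h0 := h.nonneg hy
  rcases i with n | _ | _ | l
  · simp only [repN]
    omega
  · simp only [repN]
    omega
  · simp only [repN] at h ⊢
    by_contra hj
    exact hy (h.eq_zero (repB_sub_le .z1 (by simp)) (by omega) (by omega))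
  · simp only [repN] at h ⊢
    by_contra hj
    exact hy (h.eq_zero (repB_sub_le (.t l) (by simp)) (by omega) (by omega))

lemma isShort_one_zero (n : ℤ) (b : Finf W) : IsShort W n b n 1 0 := by
  simp [IsShort]

lemma smul_ne_zero_of_gl (γ : GL (Fin 2) (A W)) {x y : A W} (hxy : x ≠ 0 ∨ y ≠ 0) :
    γ 0 0 * x + γ 0 1 * y ≠ 0 ∨ γ 1 0 * x + γ 1 1 * y ≠ 0 := by
  by_contra! h
  have hd : (γ : Matrix (Fin 2) (Fin 2) (A W)).det ≠ 0 :=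
    ((Matrix.isUnit_iff_isUnit_det _).mp γ.isUnit).ne_zero
  rw [Matrix.det_fin_two] at hd
  have hx : x = 0 := by
    refine (mul_eq_zero.mp ?_).resolve_left hd
    linear_combination γ 1 1 * h.1 - γ 0 1 * h.2
  have hy : y = 0 := by
    refine (mul_eq_zero.mp ?_).resolve_left hd
    linear_combination γ 0 0 * h.2 - γ 1 0 * h.1
  simp [hx, hy] at hxy

/-- The level of a representative is the minimum of the Γ-invariant quantity 2j - n over non-zero
vectors, so it depends only on the orbit. -/
lemma repN_le_of_rel {i i' : QuotVertex k} (h : GRel W (rep W i) (rep W i')) :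
    repN i' ≤ repN i := by
  obtain ⟨γ, hγ⟩ := h
  rw [rep_eq_pv, rep_eq_pv] at hγ
  obtain ⟨e, he, hs⟩ := isShort_smul hγ
  have := repN_le_of_isShort (smul_ne_zero_of_gl γ (.inl one_ne_zero)) (hs _ _ _ (isShort_one_zero _ _))
  omega

/-- A pair of vectors of the size that is minimal for `t_l` has determinant in `k (x - l)`. -/
lemma isShort_tv {l : k} {x y : A W} (h : IsShort W 2 (repB W (.t l)) 2 x y) :
    ∃ a : k, y = algebraMap k (A W) a * (xA W - algebraMap k (A W) l) := by
  obtain ⟨a, b, rfl⟩ := eq_of_valA_le W (vInf_AtoFinf W y ▸ h.2)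
  set ι := algebraMap k (A W)
  refine ⟨b, ?_⟩
  have hl := xInf_sub_cst_ne_zero W l
  -- The second coordinate is a + b x. Modulo A + 𝒪_∞, its product with t⁻¹ + l t is (a + b l) t⁻¹,
  -- as b (x - l) contributes b y. Shortness places this product in A + 𝒪_∞.
  have hab : a + b * l = 0 := by
    refine eq_zero_of_decomp W (f := x - ι b * yA W) ?_
    have e : cst W (a + b * l) * (tInf W)⁻¹ - AtoFinf W (x - ι b * yA W) =
        -((AtoFinf W x - repB W (.t l) * AtoFinf W (ι a + ι b * xA W)) -
          (yInf W / (xInf W - cst W l) - ((tInf W)⁻¹ + cst W l * tInf W)) *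
            (cst W b * (xInf W - cst W l)) + cst W (a + b * l) * (cst W l * tInf W)) := by
      have hy : yInf W / (xInf W - cst W l) * (cst W b * (xInf W - cst W l)) =
          cst W b * yInf W := by field_simp
      rw [sub_mul, hy, repB]
      simp only [map_sub, map_add, map_mul, ← cst_apply, ι]
      change _ - (_ - _ * yInf W) = -((_ - _ * (_ + _ * xInf W)) - _ + _)
      ring
    rw [e, Valuation.map_neg]
    refine Valuation.map_add_le _ (Valuation.map_sub_le _ ?_ ?_) ?_
    · exact h.1.trans (by simp)
    · rw [map_mul, map_mul, vInf_xInf_sub_cst]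
      calc _ ≤ WithZero.exp (-2 : ℤ) * (1 * WithZero.exp (2 : ℤ)) := by
            gcongr
            · exact vInf_div_expansion W l
            · exact vInf_cst_le W b
        _ ≤ 1 := by
            rw [one_mul, ← WithZero.exp_add, neg_add_cancel, WithZero.exp_zero]
    · rw [map_mul, map_mul, vInf_tInf]
      refine mul_le_one' (vInf_cst_le W _) (mul_le_one' (vInf_cst_le W _) ?_)
      rw [← WithZero.exp_zero, WithZero.exp_le_exp]
      simp
  have ha : a = -(b * l) := by linear_combination hab
  rw [ha, map_neg, map_mul]
  ring

lemma isShort_tv_self (l : k) : IsShort W 2 (repB W (.t l)) 2 (yA W)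
    (xA W - algebraMap k (A W) l) := by
  have hl := xInf_sub_cst_ne_zero W l
  rw [IsShort, map_sub (AtoFinf W), ← cst_apply]
  change vInf W (yInf W - _ * (xInf W - _)) ≤ _ ∧ vInf W (xInf W - _) ≤ _
  have e : yInf W - repB W (.t l) * (xInf W - cst W l) =
      (yInf W / (xInf W - cst W l) - ((tInf W)⁻¹ + cst W l * tInf W)) * (xInf W - cst W l) := by
    rw [sub_mul, div_mul_cancel₀ _ hl]
    rfl
  rw [e, map_mul, vInf_xInf_sub_cst]
  refine ⟨(mul_le_mul_left (vInf_div_expansion W l) _).trans ?_, le_rfl⟩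
  rw [← WithZero.exp_add]
  rfl

/-- Levels separate all representatives except c_0 from z_0 and the t_l from one another; the
minimal vectors separate these. -/
lemma rep_injective {i i' : QuotVertex k} (h : GRel W (rep W i) (rep W i')) : i = i' := by
  have hN := le_antisymm (repN_le_of_rel h.symm) (repN_le_of_rel h)
  -- At j = 0 both basis vectors are short for c_0, whereas every short vector for z_0 has second
  -- coordinate 0; a matrix in Γ would be singular.
  have hcz : ¬ GRel W (rep W (.c 0)) (rep W .z0) := by
    rintro ⟨γ, hγ⟩
    rw [rep_eq_pv, rep_eq_pv] at hγ
    obtain ⟨e, he, hs⟩ := isShort_smul hγ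
    simp only [repN, Nat.cast_zero, neg_zero] at he hs
    obtain rfl : e = 0 := by omega
    have h1 := (hs 0 1 0 (by simp [IsShort])).eq_zero (repB_sub_le .z0 (by simp)) (by omega) (by omega)
    have h2 := (hs 0 0 1 (by simp [IsShort, repB])).eq_zero (repB_sub_le .z0 (by simp)) (by omega)
      (by omega)
    have hd : (γ : Matrix (Fin 2) (Fin 2) (A W)).det ≠ 0 :=
      ((Matrix.isUnit_iff_isUnit_det _).mp γ.isUnit).ne_zero
    rw [Matrix.det_fin_two] at hd
    simp only [mul_one, mul_zero, add_zero, zero_add] at h1 h2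
    rw [h1, h2] at hd
    simp at hd
  rcases i with n | _ | _ | l <;> rcases i' with n' | _ | _ | l' <;> simp only [repN] at hN <;>
    try omega
  · congr; omega
  · obtain rfl : n = 0 := by omega
    exact absurd h hcz
  · obtain rfl : n' = 0 := by omega
    exact absurd h.symm hcz
  · rfl
  · rfl
  · obtain ⟨γ, hγ⟩ := h
    rw [rep_eq_pv, rep_eq_pv] at hγ
    obtain ⟨e, he, hs⟩ := isShort_smul hγ
    simp only [repN] at he hs
    obtain rfl : e = 0 := by omega
    obtain ⟨a, ha⟩ := isShort_tv (hs 2 1 0 (isShort_one_zero 2 _))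
    obtain ⟨b, hb⟩ := isShort_tv (hs 2 _ _ (isShort_tv_self l))
    set ι := algebraMap k (A W)
    set D := (γ : Matrix (Fin 2) (Fin 2) (A W)).det with hD
    have hDu : IsUnit D := (Matrix.isUnit_iff_isUnit_det _).mp γ.isUnit
    obtain ⟨d, hd⟩ := eq_const_of_valA_le W (valA_eq_one_of_isUnit hDu).le
    have hd0 : d ≠ 0 := by
      rintro rfl
      rw [map_zero] at hd
      exact hDu.ne_zero hd
    rw [Matrix.det_fin_two] at hD
    set P := γ 0 0
    set Q := γ 0 1
    -- The vectors (1, 0) and (y, x - l) are short for t_l and have determinant x - l. Both images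
    -- have second coordinate divisible by x - l', so d (x - l) is divisible by x - l'; comparing
    -- valuations makes the quotient a constant and l = l'.
    have e1 : ι d * (xA W - ι l) = (P * ι b - (P * yA W + Q * (xA W - ι l)) * ι a) * (xA W - ι l') := by
      rw [← hd, hD]
      linear_combination P * hb - (P * yA W + Q * (xA W - ι l)) * ha
    set H := P * ι b - (P * yA W + Q * (xA W - ι l)) * ι a
    have hvx : ∀ l : k, valA W (xA W - ι l) = WithZero.exp 2 := by
      intro l
      rw [← vInf_xInf_sub_cst W l, xInf, cst_apply, ← map_sub, vInf_AtoFinf]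
    have hvH : valA W H = 1 := by
      have := congrArg (valA W) e1
      rw [map_mul, map_mul, hvx, hvx, valA_const W hd0] at this
      exact (mul_right_cancel₀ WithZero.exp_ne_zero this).symm
    obtain ⟨h, hh⟩ := eq_const_of_valA_le W hvH.le
    rw [hh] at e1
    have e2 : algebraMap k[X] (A W) (C d * (X - C l)) = algebraMap k[X] (A W) (C h * (X - C l')) := by
      simp only [map_mul, map_sub]
      simpa only [xA, ι, IsScalarTower.algebraMap_apply k k[X] (A W),
        Polynomial.algebraMap_eq] using e1
    have e3 := FaithfulSMul.algebraMap_injective k[X] (A W) e2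
    have e4 := congrArg (eval l') e3
    simp only [eval_mul, eval_sub, eval_C, eval_X, sub_self, mul_zero] at e4
    have := (mul_eq_zero.mp e4).resolve_left hd0
    rw [sub_eq_zero.mp this]

/-- `A` has class number one: `GL₂(A)` acts transitively on the lines in `F²`. -/
lemma exists_gl_smul_eq_zero (hN : ∀ x y : k, ¬ W.toAffine.Equation x y) (x y : A W) :
    ∃ γ : GL (Fin 2) (A W), γ 1 0 * x + γ 1 1 * y = 0 := by
  by_cases hy : y = 0
  · exact ⟨1, by simp [hy]⟩
  have hy' : AtoFinf W y ≠ 0 := AtoFinf_ne_zero W hy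
  obtain ⟨j, hj⟩ := exists_vInf_eq W hy'
  -- At level 2j + 1 the vector (x, y) has 2j - n = -1. If its image at a representative had
  -- non-zero second coordinate, the level there would be at most -1 by `repN_le_of_isShort`, but at
  -- least 1 because the new j is non-negative.
  obtain ⟨i, γ, hγ⟩ := exists_rep hN (pv W (2 * j + 1) (AtoFinf W x / AtoFinf W y))
  rw [rep_eq_pv] at hγ
  obtain ⟨e, he, hs⟩ := isShort_smul hγ
  have h1 := hs j x y ⟨by rw [div_mul_cancel₀ _ hy', sub_self, map_zero]; exact zero_le, hj.le⟩
  refine ⟨γ, ?_⟩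
  by_contra h0
  have h2 := repN_le_of_isShort (.inr h0) h1
  have h3 := h1.nonneg h0
  omega

end

/-! ### The space `S` -/

section

variable (W : WeierstrassCurve k)

open Classical in
/-- The `Γ`-invariant function with prescribed values at the representatives. -/
def ofQuot (a : QuotVertex k → ℂ) (v : Vert W) : ℂ :=
  if h : ∃ i, GRel W v (rep W i) then a h.choose else 0

variable {W}

lemma ofQuot_of_rel (a : QuotVertex k → ℂ) {v : Vert W} {i : QuotVertex k}
    (h : GRel W v (rep W i)) : ofQuot W a v = a i := by
  have hex : ∃ i, GRel W v (rep W i) := ⟨i, h⟩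
  rw [ofQuot, dif_pos hex]
  congr 1
  exact rep_injective (hex.choose_spec.symm.trans h)

lemma ofQuot_rep (a : QuotVertex k → ℂ) (i : QuotVertex k) : ofQuot W a (rep W i) = a i :=
  ofQuot_of_rel a (.of_eq rfl)

lemma isGamInvariant_ofQuot (hN : ∀ x y : k, ¬ W.toAffine.Equation x y) (a : QuotVertex k → ℂ) :
    IsGamInvariant W (ofQuot W a) := by
  rintro _ ⟨γ, rfl⟩ v
  obtain ⟨i, hi⟩ := exists_rep hN v
  rw [ofQuot_of_rel a hi]
  exact ofQuot_of_rel a (GRel.trans (GRel.symm ⟨γ, rfl⟩) hi)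

lemma IsGamInvariant.ext (hN : ∀ x y : k, ¬ W.toAffine.Equation x y) {f g : Vert W → ℂ}
    (hf : IsGamInvariant W f) (hg : IsGamInvariant W g) (h : ∀ i, f (rep W i) = g (rep W i)) :
    f = g := by
  ext v
  obtain ⟨i, hi⟩ := exists_rep hN v
  rw [hf.eq hi, hg.eq hi, h]

lemma adj_smul_iff (g : Ginf W) (v w : Vert W) : Adj W (g • v) (g • w) ↔ Adj W v w := by
  refine ⟨fun h ↦ ?_, fun h ↦ h.smul g⟩
  have := h.smul g⁻¹
  rwa [inv_smul_smul, inv_smul_smul] at this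

lemma isGamInvariant_Phi {f : Vert W → ℂ} (hf : IsGamInvariant W f) :
    IsGamInvariant W (Phi W f) := by
  intro γ hγ v
  rw [Phi, Phi, ← finsum_comp_equiv (MulAction.toPerm γ)]
  refine finsum_congr fun w ↦ ?_
  simp only [MulAction.toPerm_apply, adj_smul_iff, hf γ hγ w]

/-- The coefficients of `f(c_n)` with respect to `f(z_0)`, `f(t_1) + ⋯ + f(t_q)` and `f(z_1)`. -/
def coef (q : ℂ) : ℕ → ℂ × ℂ × ℂ
  | 0 => (0, -2, 0)
  | 1 => (0, 0, -2 * q)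
  | 2 => (-2 * q - (q - 1), -2 * q + 2, 0)
  | n + 3 => ((coef q (n + 2)).2.2 - q * (coef q (n + 1)).1,
      (coef q (n + 2)).2.2 - q * (coef q (n + 1)).2.1,
      -q * (coef q (n + 2)).1 + q * (q + 1) * (coef q (n + 2)).2.1 - q * (coef q (n + 1)).2.2)

/-- The recursion shifts n by one while Φ exchanges z_1 with z_0 and the t_l, so the parity pattern
demanded of the constants is automatic. -/
lemma coef_parity (q : ℂ) (n : ℕ) : (Even n → (coef q n).2.2 = 0) ∧
    (¬ Even n → (coef q n).1 = 0 ∧ (coef q n).2.1 = 0) := by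
  induction n using Nat.strong_induction_on with
  | _ n ih =>
    match n with
    | 0 => simp [coef]
    | 1 => simp [coef]
    | 2 => simp [coef]
    | n + 3 =>
      have h1 := ih (n + 1) (by omega)
      have h2 := ih (n + 2) (by omega)
      have e3 : Even (n + 3) ↔ Even (n + 1) := by simp [Nat.even_add_one]
      have e2 : Even (n + 2) ↔ ¬ Even (n + 1) := by simp [Nat.even_add_one]
      rw [coef, e3]
      rw [e2, not_not] at h2
      constructor
      · intro h
        simp [h1.1 h, h2.2 h]
      · intro h
        simp [h1.2 h, h2.1 h]

variable [Fintype k]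

/-- The value at `c_n` as a linear form in the values at `z_0`, `z_1` and the `t_l`. -/
def cval (n : ℕ) (f : Vert W → ℂ) : ℂ :=
  (coef (Fintype.card k) n).1 * f (z0 W) + (coef (Fintype.card k) n).2.1 * ∑ l : k, f (tv W l) +
    (coef (Fintype.card k) n).2.2 * f (z1 W)

lemma cval_eq (n : ℕ) (f : Vert W → ℂ) : cval n f =
    if Even n then (coef (Fintype.card k) n).1 * f (z0 W) +
      (coef (Fintype.card k) n).2.1 * ∑ l : k, f (tv W l)
    else (coef (Fintype.card k) n).2.2 * f (z1 W) := by
  have h := coef_parity (Fintype.card k : ℂ) n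
  rw [cval]
  split_ifs with hn
  · rw [h.1 hn, zero_mul, add_zero]
  · rw [(h.2 hn).1, (h.2 hn).2, zero_mul, zero_mul, zero_add, zero_add]

variable (W) in
/-- The space of invariant functions whose values at the vertices `c_n` are prescribed by the
values at the other vertices. -/
def spaceS : Submodule ℂ (Vert W → ℂ) where
  carrier := {f | IsGamInvariant W f ∧ ∀ n, f (c W n) = cval n f}
  zero_mem' := ⟨fun _ _ _ ↦ rfl, fun n ↦ by simp [cval]⟩
  add_mem' {f g} hf hg := ⟨fun γ hγ v ↦ by rw [Pi.add_apply, Pi.add_apply, hf.1 γ hγ, hg.1 γ hγ],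
    fun n ↦ by
      rw [Pi.add_apply, hf.2, hg.2]
      simp only [cval, Pi.add_apply, Finset.sum_add_distrib]
      ring⟩
  smul_mem' a f hf := ⟨fun γ hγ v ↦ by rw [Pi.smul_apply, Pi.smul_apply, hf.1 γ hγ],
    fun n ↦ by
      rw [Pi.smul_apply, hf.2]
      simp only [cval, Pi.smul_apply, smul_eq_mul, ← Finset.mul_sum]
      ring⟩

lemma mem_spaceS {f : Vert W → ℂ} :
    f ∈ spaceS W ↔ IsGamInvariant W f ∧ ∀ n, f (c W n) = cval n f := Iff.rfl

lemma sum_Phi_tv (hN : ∀ x y : k, ¬ W.toAffine.Equation x y) {f : Vert W → ℂ}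
    (hf : IsGamInvariant W f) : ∑ l : k, Phi W f (tv W l) =
      Fintype.card k * (Fintype.card k + 1) * f (z1 W) := by
  rw [Finset.sum_congr rfl fun l _ ↦ Phi_tv hf hN l, Finset.sum_const, Finset.card_univ,
    nsmul_eq_mul, mul_assoc]

lemma c_zero_of_mem {f : Vert W → ℂ} (hf : f ∈ spaceS W) :
    f (c W 0) = -2 * ∑ l : k, f (tv W l) := by
  rw [hf.2 0, cval, coef]; ring

lemma c_one_of_mem {f : Vert W → ℂ} (hf : f ∈ spaceS W) :
    f (c W 1) = -2 * Fintype.card k * f (z1 W) := by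
  rw [hf.2 1, cval, coef]; ring

lemma Phi_z0_of_mem {f : Vert W → ℂ} (hf : f ∈ spaceS W) :
    Phi W f (z0 W) = -Fintype.card k * f (z1 W) := by
  rw [Phi_z0 hf.1, c_one_of_mem hf]; ring

/-- The recursion for `coef` is what makes this work: the relation at n for Φf follows from the
relations for f at c_{n+1} and, for n > 0, at c_{n-1}. -/
lemma Phi_mem_spaceS (hN : ∀ x y : k, ¬ W.toAffine.Equation x y) {f : Vert W → ℂ}
    (hf : f ∈ spaceS W) : Phi W f ∈ spaceS W := by
  refine ⟨isGamInvariant_Phi hf.1, fun n ↦ ?_⟩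
  rw [cval, Phi_z0_of_mem hf, sum_Phi_tv hN hf.1, Phi_z1]
  match n with
  | 0 =>
    rw [Phi_c_zero hf.1, hf.2 1]
    simp only [cval, coef]
    ring
  | 1 =>
    rw [Phi_c_one hf.1, hf.2 2, hf.2 0]
    simp only [cval, coef]
    ring
  | n + 2 =>
    rw [Phi_c_add_two hf.1, hf.2 (n + 3), hf.2 (n + 1)]
    simp only [cval]
    rw [coef]
    ring

lemma isSpaceS_spaceS (hN : ∀ x y : k, ¬ W.toAffine.Equation x y) : IsSpaceS W (spaceS W) := by
  refine ⟨fun f hf ↦ Phi_mem_spaceS hN hf, fun n ↦ (coef (Fintype.card k) n).1,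
    fun n ↦ (coef (Fintype.card k) n).2.1, fun n ↦ (coef (Fintype.card k) n).2.2, rfl, rfl,
    fun f ↦ ?_⟩
  rw [mem_spaceS]
  simp only [cval_eq]

/-- Applying the relation at c_n to Φf in S and expanding by the neighbours solves for f(c_{n+1}).
Starting from f(c_0) = -2T, this reproduces the recursion for `coef`. -/
lemma le_spaceS (hN : ∀ x y : k, ¬ W.toAffine.Equation x y) {S : Submodule ℂ (Vert W → ℂ)}
    (hS : IsSpaceS W S) : S ≤ spaceS W := by
  obtain ⟨hst, lam, mu, nu, hl, hm, hmem⟩ := hS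
  suffices H : ∀ n, ∀ f ∈ S, f (c W n) = cval n f from
    fun f hf ↦ ⟨((hmem f).mp hf).1, fun n ↦ H n f hf⟩
  have hinv : ∀ f ∈ S, IsGamInvariant W f := fun f hf ↦ ((hmem f).mp hf).1
  have H0 : ∀ f ∈ S, f (c W 0) = cval 0 f := by
    intro f hf
    rw [((hmem f).mp hf).2 0, if_pos (by simp), hl, hm, cval, coef]
    ring
  have H1 : ∀ f ∈ S, f (c W 1) = cval 1 f := by
    intro f hf
    have h := H0 _ (hst f hf)
    rw [Phi_c_zero (hinv f hf), cval, coef, sum_Phi_tv hN (hinv f hf)] at h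
    rw [cval, coef]
    apply mul_left_cancel₀ (Nat.cast_add_one_ne_zero (R := ℂ) (Fintype.card k))
    linear_combination h
  intro n
  induction n using Nat.strong_induction_on with
  | _ n ih =>
    intro f hf
    match n with
    | 0 => exact H0 f hf
    | 1 => exact H1 f hf
    | 2 =>
      have h := H1 _ (hst f hf)
      rw [Phi_c_one (hinv f hf), cval, coef, Phi_z1, H0 f hf, cval, coef] at h
      rw [cval, coef]
      linear_combination h
    | n + 3 =>
      have h := ih (n + 2) (by omega) _ (hst f hf)
      have h1 := H1 f hf
      rw [cval, coef] at h1
      rw [Phi_c_add_two (hinv f hf), cval, Phi_z1, sum_Phi_tv hN (hinv f hf), Phi_z0 (hinv f hf),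
        ih (n + 1) (by omega) f hf, cval] at h
      rw [cval, coef]
      linear_combination h + (coef (Fintype.card k) (n + 2)).1 * h1

/-- Given f in `spaceS`, the constants of S define an element of S with the same values at z_0, z_1
and the t_l. It lies in `spaceS` too, so its values at the c_n are those of f. Thus f satisfies the
relations of S, even where the constants need not be compared one by one. -/
lemma eq_spaceS (hN : ∀ x y : k, ¬ W.toAffine.Equation x y) {S : Submodule ℂ (Vert W → ℂ)}
    (hS : IsSpaceS W S) : S = spaceS W := by
  refine le_antisymm (le_spaceS hN hS) fun f hf ↦ ?_
  have hle := le_spaceS hN hS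
  obtain ⟨hst, lam, mu, nu, hl, hm, hmem⟩ := hS
  set a : QuotVertex k → ℂ := fun i ↦ match i with
    | .c n => if Even n then lam n * f (z0 W) + mu n * ∑ l : k, f (tv W l) else nu n * f (z1 W)
    | .z0 => f (z0 W)
    | .z1 => f (z1 W)
    | .t l => f (tv W l)
  have hz0 : ofQuot W a (z0 W) = f (z0 W) := ofQuot_rep a .z0
  have hz1 : ofQuot W a (z1 W) = f (z1 W) := ofQuot_rep a .z1
  have ht : ∀ l, ofQuot W a (tv W l) = f (tv W l) := fun l ↦ ofQuot_rep a (.t l)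
  have hc : ∀ n, ofQuot W a (c W n) = a (.c n) := fun n ↦ ofQuot_rep a (.c n)
  have hg : ofQuot W a ∈ S := by
    rw [hmem]
    refine ⟨isGamInvariant_ofQuot hN a, fun n ↦ ?_⟩
    rw [hc, hz0, hz1]
    simp only [ht]
    rfl
  rw [hmem]
  refine ⟨hf.1, fun n ↦ ?_⟩
  have h1 := (hle hg).2 n
  rw [hc, cval, hz0, hz1] at h1
  simp only [ht] at h1
  rw [hf.2 n, cval, ← h1]

variable (W) in
/-- Restriction of a function to the vertices `z_0`, `z_1` and `t_l`. -/
def evalS : spaceS W →ₗ[ℂ] ℂ × ℂ × (k → ℂ) where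
  toFun f := (f.1 (z0 W), f.1 (z1 W), fun l ↦ f.1 (tv W l))
  map_add' _ _ := rfl
  map_smul' _ _ := rfl

lemma evalS_bijective (hN : ∀ x y : k, ¬ W.toAffine.Equation x y) :
    Function.Bijective (evalS W) := by
  constructor
  · rintro ⟨f, hf⟩ ⟨g, hg⟩ h
    have h0 : f (z0 W) = g (z0 W) := congrArg Prod.fst h
    have h1 : f (z1 W) = g (z1 W) := congrArg (fun p ↦ p.2.1) h
    have ht : ∀ l, f (tv W l) = g (tv W l) := fun l ↦ congrFun (congrArg (fun p ↦ p.2.2) h) l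
    apply Subtype.ext
    refine hf.1.ext hN hg.1 fun i ↦ ?_
    rcases i with n | _ | _ | l
    · change f (c W n) = g (c W n)
      rw [hf.2, hg.2, cval, cval, h0, h1]
      simp only [ht]
    · exact h0
    · exact h1
    · exact ht l
  · rintro ⟨a0, a1, at'⟩
    set a : QuotVertex k → ℂ := fun i ↦ match i with
      | .c n => (coef (Fintype.card k) n).1 * a0 + (coef (Fintype.card k) n).2.1 * ∑ l : k, at' l +
          (coef (Fintype.card k) n).2.2 * a1
      | .z0 => a0
      | .z1 => a1
      | .t l => at' l
    have hz0 : ofQuot W a (z0 W) = a0 := ofQuot_rep a .z0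
    have hz1 : ofQuot W a (z1 W) = a1 := ofQuot_rep a .z1
    have ht : ∀ l, ofQuot W a (tv W l) = at' l := fun l ↦ ofQuot_rep a (.t l)
    have hc : ∀ n, ofQuot W a (c W n) = a (.c n) := fun n ↦ ofQuot_rep a (.c n)
    refine ⟨⟨ofQuot W a, isGamInvariant_ofQuot hN a, fun n ↦ ?_⟩, ?_⟩
    · rw [hc, cval, hz0, hz1]
      simp only [ht]
      rfl
    · change (ofQuot W a (z0 W), ofQuot W a (z1 W), fun l ↦ ofQuot W a (tv W l)) = _
      simp only [hz0, hz1, ht]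

end

/-! ### Constant terms -/

section

variable (W : WeierstrassCurve k)

variable {W}

/-- Every cusp is equivalent to the standard one: a matrix over `F` becomes upper triangular after
multiplication with an element of `Γ`. -/
lemma exists_cusp_data (hN : ∀ x y : k, ¬ W.toAffine.Equation x y) (γ : GL (Fin 2) (F W)) :
    ∃ (γ' : GL (Fin 2) (A W)) (r : Finf W), r ≠ 0 ∧ ∀ x,
      (Matrix.GeneralLinearGroup.map (AtoFinf W) γ' *
        Matrix.GeneralLinearGroup.map (toFinf W) γ) * unip W x =
      unip W (r * x) * (Matrix.GeneralLinearGroup.map (AtoFinf W) γ' *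
        Matrix.GeneralLinearGroup.map (toFinf W) γ) := by
  obtain ⟨a, b, hb, hab⟩ := IsFractionRing.div_surjective (A := A W) (γ 0 0)
  obtain ⟨c, d, hd, hcd⟩ := IsFractionRing.div_surjective (A := A W) (γ 1 0)
  -- The first column (a/b, c/d) of γ is proportional to (a d, c b), which has entries in A.
  obtain ⟨γ', hγ'⟩ := exists_gl_smul_eq_zero hN (a * d) (c * b)
  obtain ⟨M, hM⟩ : ∃ M : Ginf W, M = Matrix.GeneralLinearGroup.map (AtoFinf W) γ' *
        Matrix.GeneralLinearGroup.map (toFinf W) γ := ⟨_, rfl⟩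
  have hb0 : AtoFinf W b ≠ 0 := AtoFinf_ne_zero W (nonZeroDivisors.ne_zero hb)
  have hd0 : AtoFinf W d ≠ 0 := AtoFinf_ne_zero W (nonZeroDivisors.ne_zero hd)
  have h10 : M 1 0 = 0 := by
    have e : M 1 0 = AtoFinf W (γ' 1 0) * toFinf W (γ 0 0) +
        AtoFinf W (γ' 1 1) * toFinf W (γ 1 0) := by
      rw [hM, Units.val_mul, Matrix.mul_apply, Fin.sum_univ_two]
      rfl
    have h1 : toFinf W (γ 0 0) = AtoFinf W a / AtoFinf W b := by rw [← hab, map_div₀]; rfl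
    have h2 : toFinf W (γ 1 0) = AtoFinf W c / AtoFinf W d := by rw [← hcd, map_div₀]; rfl
    have h3 := congrArg (AtoFinf W) hγ'
    simp only [map_add, map_mul, map_zero] at h3
    rw [e, h1, h2]
    field_simp
    linear_combination h3
  have hdet : M 0 0 * M 1 1 ≠ 0 := by
    have h := ((Matrix.isUnit_iff_isUnit_det _).mp M.isUnit).ne_zero
    rwa [Matrix.det_fin_two, h10, mul_zero, sub_zero] at h
  have h00 := left_ne_zero_of_mul hdet
  have h11 := right_ne_zero_of_mul hdet
  refine ⟨γ', M 0 0 / M 1 1, div_ne_zero h00 h11, fun x ↦ ?_⟩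
  apply Units.ext
  rw [← hM, Units.val_mul, Units.val_mul, unip, unip, coe_psl, coe_psl,
    Matrix.eta_fin_two (M : Matrix (Fin 2) (Fin 2) (Finf W)), Matrix.mul_fin_two,
    Matrix.mul_fin_two, h10]
  have e : M 0 0 / M 1 1 * x * M 1 1 = M 0 0 * x := by
    rw [mul_right_comm, div_mul_cancel₀ _ h11]
  simp only [Units.val_one, mul_one, mul_zero, one_mul, zero_mul, add_zero, zero_add,
    Matrix.of_apply, Matrix.cons_val_zero, Matrix.cons_val_one, e]
  rw [add_comm]

lemma unip_mem_Gam_iff (z : Finf W) : unip W z ∈ Gam W ↔ ∃ a, AtoFinf W a = z := by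
  constructor
  · rintro ⟨γ, hγ⟩
    refine ⟨γ 0 1, ?_⟩
    have := congrArg (fun g : Ginf W ↦ g 0 1) hγ
    simpa [unip, coe_psl] using this
  · rintro ⟨a, rfl⟩
    exact ⟨psl 1 a, by rw [map_psl, map_one]; rfl⟩

lemma mem_cuspLattice_iff {γ : GL (Fin 2) (F W)} {γ' : GL (Fin 2) (A W)} {r : Finf W}
    (h : ∀ x, (Matrix.GeneralLinearGroup.map (AtoFinf W) γ' *
        Matrix.GeneralLinearGroup.map (toFinf W) γ) * unip W x =
      unip W (r * x) * (Matrix.GeneralLinearGroup.map (AtoFinf W) γ' *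
        Matrix.GeneralLinearGroup.map (toFinf W) γ)) (x : Finf W) :
    x ∈ cuspLattice W γ ↔ ∃ a, AtoFinf W a = r * x := by
  rw [← unip_mem_Gam_iff]
  have hg : Matrix.GeneralLinearGroup.map (AtoFinf W) γ' ∈ Gam W := ⟨γ', rfl⟩
  change _ * _ * _ ∈ Gam W ↔ _
  rw [← Subgroup.mul_mem_cancel_left _ hg, ← Subgroup.mul_mem_cancel_right _ (inv_mem hg)]
  have e := h x
  rw [← mul_inv_eq_iff_eq_mul, mul_inv_rev] at e
  rw [← e]
  simp only [mul_assoc]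

lemma unip_smul_pv (z b : Finf W) (n : ℤ) : unip W z • pv W n b = pv W n (z + b) := by
  change vert W (_ * _) = _
  rw [unip, psl_mul, one_mul, Units.val_one, one_mul, add_comm, pv]

/-- Invariance allows γ' to be inserted on the left; the triangular matrix γ'γ then moves past the
unipotent factor and rescales its argument by r. -/
lemma cusp_integrand {f : Vert W → ℂ} (hf : IsGamInvariant W f) {γ : GL (Fin 2) (F W)}
    {γ' : GL (Fin 2) (A W)} {r : Finf W}
    (h : ∀ x, (Matrix.GeneralLinearGroup.map (AtoFinf W) γ' *
        Matrix.GeneralLinearGroup.map (toFinf W) γ) * unip W x =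
      unip W (r * x) * (Matrix.GeneralLinearGroup.map (AtoFinf W) γ' *
        Matrix.GeneralLinearGroup.map (toFinf W) γ)) {g : Ginf W} {n : ℤ} {b : Finf W}
    (hg : vert W (Matrix.GeneralLinearGroup.map (AtoFinf W) γ' *
        Matrix.GeneralLinearGroup.map (toFinf W) γ * g) = pv W n b) (x : Finf W) :
    f (vert W (Matrix.GeneralLinearGroup.map (toFinf W) γ * unip W x * g)) =
      f (pv W n (r * x + b)) := by
  rw [← unip_smul_pv, ← hg, ← hf _ ⟨γ', rfl⟩]
  congr 1
  change vert W (Matrix.GeneralLinearGroup.map (AtoFinf W) γ' *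
    (Matrix.GeneralLinearGroup.map (toFinf W) γ * unip W x * g)) = vert W (unip W (r * x) *
      (Matrix.GeneralLinearGroup.map (AtoFinf W) γ' *
        Matrix.GeneralLinearGroup.map (toFinf W) γ * g))
  rw [← mul_assoc, ← mul_assoc, h]
  simp only [mul_assoc]

section Integral

open MeasureTheory

variable {Λ : AddSubgroup (Finf W)} {r : Finf W} {f : Vert W → ℂ}

/-- The function on `F_∞ / Λ` whose integral is a constant term. -/
def cuspFun (r : Finf W) (f : Vert W → ℂ) (n : ℤ) (b : Finf W) (x : Finf W ⧸ Λ) : ℂ :=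
  f (pv W n (r * x.out + b))

lemma cuspFun_mk (hΛ : ∀ x, x ∈ Λ ↔ ∃ a, AtoFinf W a = r * x)
    (hf : IsGamInvariant W f) (n : ℤ) (b x : Finf W) :
    cuspFun (Λ := Λ) r f n b (QuotientAddGroup.mk x) = f (pv W n (r * x + b)) := by
  rw [cuspFun]
  have h : -x + (QuotientAddGroup.mk x : Finf W ⧸ Λ).out ∈ Λ := by
    rw [← QuotientAddGroup.eq]
    exact (Quotient.out_eq' _).symm
  obtain ⟨a, ha⟩ := (hΛ _).mp h
  refine hf.eq (GRel.pv_affine W one_ne_zero (-a) ?_)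
  rw [map_neg, ha, map_one]
  have e : 1 * (r * (QuotientAddGroup.mk x : Finf W ⧸ Λ).out + b) +
    -(r * (-x + (QuotientAddGroup.mk x : Finf W ⧸ Λ).out)) - (r * x + b) = 0 := by ring
  rw [e, map_zero]
  exact zero_le

lemma continuous_cuspFun (hr : r ≠ 0) (hΛ : ∀ x, x ∈ Λ ↔ ∃ a, AtoFinf W a = r * x)
    (hf : IsGamInvariant W f) (n : ℤ) (b : Finf W) : Continuous (cuspFun (Λ := Λ) r f n b) := by
  rw [(QuotientAddGroup.isQuotientMap_mk (N := Λ)).continuous_iff]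
  have e : cuspFun (Λ := Λ) r f n b ∘ QuotientAddGroup.mk = fun x ↦ f (pv W n (r * x + b)) :=
    funext fun x ↦ cuspFun_mk hΛ hf n b x
  rw [e, continuous_iff_continuousAt]
  intro x
  refine ContinuousAt.congr (f := fun _ ↦ f (pv W n (r * x + b))) continuousAt_const ?_
  have hne : r⁻¹ * tInf W ^ n ≠ 0 := mul_ne_zero (inv_ne_zero hr) (zpow_ne_zero _ (tInf_ne_zero W))
  filter_upwards [ball_mem_nhds W x hne] with y hy
  congr 1
  rw [pv_eq_iff]
  refine ⟨rfl, ?_⟩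
  rw [add_sub_add_right_eq_sub, ← mul_sub, map_mul, Valuation.map_sub_swap]
  have h0 : vInf W r ≠ 0 := by simpa using hr
  rw [map_mul, map_inv₀, vInf_tInf_zpow] at hy
  calc _ ≤ vInf W r * ((vInf W r)⁻¹ * WithZero.exp (-n)) := mul_le_mul_right hy.le _
    _ = _ := by rw [← mul_assoc, mul_inv_cancel₀ h0, one_mul]

/-- By the decomposition of F_∞, the compact set t⁻¹𝒪_∞ maps onto F_∞/A; multiplication by r
identifies the present quotient with this one. -/
lemma compactSpace_quotient (hr : r ≠ 0) (hΛ : ∀ x, x ∈ Λ ↔ ∃ a, AtoFinf W a = r * x)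
    [Finite k] : CompactSpace (Finf W ⧸ Λ) := by
  constructor
  have hc : IsCompact ((fun z ↦ (QuotientAddGroup.mk (r⁻¹ * ((tInf W)⁻¹ * z)) : Finf W ⧸ Λ)) ''
      {z : Finf W | vInf W z ≤ 1}) := by
    refine (isCompact_integer W).image ?_
    refine continuous_quot_mk.comp ?_
    exact continuous_const.mul (continuous_const.mul continuous_id)
  refine hc.of_isClosed_subset isClosed_univ ?_
  rintro q -
  obtain ⟨x, rfl⟩ := QuotientAddGroup.mk_surjective q
  obtain ⟨a, c, h⟩ := exists_decomp W (r * x)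
  have ht := tInf_ne_zero W
  refine ⟨tInf W * (r * x - AtoFinf W a), ?_, ?_⟩
  · have e : tInf W * (r * x - AtoFinf W a) =
        tInf W * (r * x - AtoFinf W a - cst W c * (tInf W)⁻¹) + cst W c := by
      field_simp
      ring
    rw [Set.mem_ofPred_eq, e]
    refine Valuation.map_add_le _ ?_ (vInf_cst_le W c)
    rw [map_mul, vInf_tInf]
    refine mul_le_one' ?_ h
    rw [← WithZero.exp_zero, WithZero.exp_le_exp]
    simp
  · rw [QuotientAddGroup.eq, hΛ]
    refine ⟨a, ?_⟩
    rw [inv_mul_cancel_left₀ ht]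
    field_simp
    ring

variable [MeasurableSpace (Finf W ⧸ Λ)] [BorelSpace (Finf W ⧸ Λ)]
  (μ : Measure (Finf W ⧸ Λ)) [μ.IsAddHaarMeasure]

lemma integrable_cuspFun (hr : r ≠ 0) (hΛ : ∀ x, x ∈ Λ ↔ ∃ a, AtoFinf W a = r * x)
    (hf : IsGamInvariant W f) [Finite k] (n : ℤ) (b : Finf W) :
    Integrable (cuspFun (Λ := Λ) r f n b) μ := by
  have := compactSpace_quotient hr hΛ
  exact (continuous_cuspFun hr hΛ hf n b).integrable_of_hasCompactSupport
    (HasCompactSupport.of_compactSpace _)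

/-- A change of b is a translation of the variable by r⁻¹z. Hence the constant term depends only on
the level n, and Φ acts on it by a two-term recursion. -/
lemma integral_cuspFun_add (hr : r ≠ 0) (hΛ : ∀ x, x ∈ Λ ↔ ∃ a, AtoFinf W a = r * x)
    (hf : IsGamInvariant W f) (n : ℤ) (b z : Finf W) :
    ∫ x, cuspFun (Λ := Λ) r f n (b + z) x ∂μ = ∫ x, cuspFun (Λ := Λ) r f n b x ∂μ := by
  rw [← integral_add_right_eq_self (cuspFun (Λ := Λ) r f n b) (QuotientAddGroup.mk (r⁻¹ * z))]
  congr 1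
  ext q
  obtain ⟨x, rfl⟩ := QuotientAddGroup.mk_surjective q
  rw [← QuotientAddGroup.mk_add, cuspFun_mk hΛ hf, cuspFun_mk hΛ hf]
  congr 2
  rw [mul_add, mul_inv_cancel_left₀ hr]
  ring

/-- The Hecke operator acts on constant terms. -/
lemma integral_cuspFun_Phi (hr : r ≠ 0) (hΛ : ∀ x, x ∈ Λ ↔ ∃ a, AtoFinf W a = r * x)
    (hf : IsGamInvariant W f) [Fintype k] (n : ℤ) (b : Finf W) :
    ∫ x, cuspFun (Λ := Λ) r (Phi W f) n b x ∂μ = ∫ x, cuspFun (Λ := Λ) r f (n - 1) b x ∂μ +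
      Fintype.card k * ∫ x, cuspFun (Λ := Λ) r f (n + 1) b x ∂μ := by
  have e : ∀ x : Finf W ⧸ Λ, cuspFun r (Phi W f) n b x = cuspFun r f (n - 1) b x +
      ∑ a : k, cuspFun r f (n + 1) (b + cst W a * tInf W ^ n) x := by
    intro x
    simp only [cuspFun]
    rw [Phi_pv]
    simp only [add_assoc]
  simp only [e]
  rw [integral_add (integrable_cuspFun μ hr hΛ hf _ _)
    (integrable_finsetSum _ fun a _ ↦ integrable_cuspFun μ hr hΛ hf _ _),
    integral_finsetSum _ fun a _ ↦ integrable_cuspFun μ hr hΛ hf _ _,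
    Finset.sum_congr rfl fun a _ ↦ integral_cuspFun_add μ hr hΛ hf _ _ _, Finset.sum_const,
    Finset.card_univ, nsmul_eq_mul]

end Integral

end

/-! ### The cusp forms in `S` -/

section

variable (W : WeierstrassCurve k)

open MeasureTheory

variable {W}

lemma apply_pv_eq_zero {f : Vert W → ℂ} (hf : IsGamInvariant W f) (hc : ∀ n, f (c W n) = 0)
    (hz : f (z0 W) = 0) {n : ℤ} (hn : n ≤ 0) (b : Finf W) : f (pv W n b) = 0 := by
  rcases hn.lt_or_eq with hn | rfl
  · obtain ⟨m, rfl⟩ : ∃ m : ℕ, n = -(m + 1 : ℕ) := ⟨(-n - 1).toNat, by push_cast; omega⟩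
    rw [hf.eq (pv_neg_rel_c W m b), hc]
  · rcases pv_zero_rel W b with h | h
    · rw [hf.eq h, hc]
    · rw [hf.eq h, hz]

variable [Fintype k]

/-- An invariant function in the kernel of the Hecke operator that vanishes at the vertices
`c_n` and `z_0` is a cusp form. -/
lemma isCuspForm_of_Phi_eq_zero (hN : ∀ x y : k, ¬ W.toAffine.Equation x y) {f : Vert W → ℂ}
    (hf : IsGamInvariant W f) (hPhi : Phi W f = 0) (hc : ∀ n, f (c W n) = 0) (hz : f (z0 W) = 0) :
    IsCuspForm W f := by
  intro γ g
  let _ : MeasurableSpace (Finf W ⧸ cuspLattice W γ) := borel _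
  have : BorelSpace (Finf W ⧸ cuspLattice W γ) := ⟨rfl⟩
  intro μ hμ
  obtain ⟨γ', r, hr, h⟩ := exists_cusp_data hN γ
  obtain ⟨n, b, hg⟩ := exists_eq_pv W (vert W (Matrix.GeneralLinearGroup.map (AtoFinf W) γ' *
        Matrix.GeneralLinearGroup.map (toFinf W) γ * g))
  have hΛ := mem_cuspLattice_iff h
  simp only [cusp_integrand hf h hg]
  have hneg : ∀ {n : ℤ}, n ≤ 0 → ∀ b, ∫ x, cuspFun (Λ := cuspLattice W γ) r f n b x ∂μ = 0 := by
    intro n hn b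
    simp only [cuspFun, apply_pv_eq_zero hf hc hz hn, integral_zero]
  -- The recursion J_{m-1} + q J_{m+1} = 0 has two steps, so the induction carries two consecutive
  -- levels.
  have hpos : ∀ m : ℕ, (∀ b, ∫ x, cuspFun (Λ := cuspLattice W γ) r f m b x ∂μ = 0) ∧
      ∀ b, ∫ x, cuspFun (Λ := cuspLattice W γ) r f (m - 1) b x ∂μ = 0 := by
    intro m
    induction m with
    | zero => exact ⟨hneg (by simp), hneg (by simp)⟩
    | succ m ih =>
      rw [Nat.cast_succ, add_sub_cancel_right]
      refine ⟨fun b ↦ ?_, ih.1⟩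
      have h1 := integral_cuspFun_Phi μ hr hΛ hf m b
      rw [hPhi, ih.2, zero_add] at h1
      have h2 : ∫ x, cuspFun (Λ := cuspLattice W γ) r (0 : Vert W → ℂ) m b x ∂μ = 0 := by
        simp [cuspFun]
      rw [h2] at h1
      exact (mul_eq_zero.mp h1.symm).resolve_left (Nat.cast_ne_zero.mpr Fintype.card_ne_zero)
  rcases le_total n 0 with hn | hn
  · exact hneg hn b
  · obtain ⟨m, rfl⟩ := Int.eq_ofNat_of_zero_le hn
    exact (hpos m).1 b

/-- The constant terms of a cusp form at the vertices `c_n`. -/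
lemma IsCuspForm.apply_c (hN : ∀ x y : k, ¬ W.toAffine.Equation x y) {f : Vert W → ℂ}
    (hf : IsGamInvariant W f) (hcusp : IsCuspForm W f) :
    (∀ n : ℕ, f (c W (n + 1)) = 0) ∧ f (c W 0) + (Fintype.card k - 1) * f (z0 W) = 0 := by
  classical
  let _ : MeasurableSpace (Finf W ⧸ cuspLattice W 1) := borel _
  have : BorelSpace (Finf W ⧸ cuspLattice W 1) := ⟨rfl⟩
  obtain ⟨γ', r, hr, h⟩ := exists_cusp_data hN 1
  have hΛ := mem_cuspLattice_iff h
  have hcpt := compactSpace_quotient hr hΛ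
  let μ : Measure (Finf W ⧸ cuspLattice W 1) := Measure.addHaar
  have hJ : ∀ n b, ∫ x, cuspFun (Λ := cuspLattice W 1) r f n b x ∂μ = 0 := by
    intro n b
    -- The choice of g makes γ' g equal to the matrix of the vertex `pv W n b`.
    have h1 := hcusp 1 ((Matrix.GeneralLinearGroup.map (AtoFinf W) γ' *
        Matrix.GeneralLinearGroup.map (toFinf W) 1)⁻¹ * psl (t W ^ n) b) μ inferInstance
    simp only [cusp_integrand hf h (n := n) (b := b) (by rw [mul_inv_cancel_left, pv])] at h1
    exact h1
  have hμ : μ.real Set.univ ≠ 0 := by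
    rw [measureReal_def]
    exact (ENNReal.toReal_pos (IsOpen.measure_pos μ isOpen_univ Set.univ_nonempty).ne'
      (measure_ne_top μ _)).ne'
  have hconst : ∀ a : ℂ, ∫ _x : Finf W ⧸ cuspLattice W 1, a ∂μ = 0 → a = 0 := by
    intro a ha
    rw [integral_const, Complex.real_smul] at ha
    exact (mul_eq_zero.mp ha).resolve_left (by exact_mod_cast hμ)
  refine ⟨fun n ↦ hconst _ ?_, hconst _ ?_⟩
  · rw [← hJ (-(n + 1 : ℕ)) 0]
    congr 1
    ext x
    rw [cuspFun, hf.eq (pv_neg_rel_c W n _)]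
  -- Summing over the translates by a t⁻¹ makes the integrand constant: whatever the t⁻¹-coefficient
  -- of r x, exactly one translate lies over c_0 and the other q - 1 over z_0.
  · have e : ∀ x : Finf W ⧸ cuspLattice W 1, f (c W 0) + (Fintype.card k - 1) * f (z0 W) =
        ∑ a : k, cuspFun r f 0 (cst W a * (tInf W)⁻¹) x := by
      intro x
      obtain ⟨p, a₀, hp⟩ := exists_decomp W (r * x.out)
      have h1 : ∀ a : k, cuspFun r f 0 (cst W a * (tInf W)⁻¹) x =
          f (z0 W) + if a = -a₀ then f (c W 0) - f (z0 W) else 0 := by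
        intro a
        have h2 : GRel W (pv W 0 (r * x.out + cst W a * (tInf W)⁻¹))
            (pv W 0 (cst W (a₀ + a) * (tInf W)⁻¹)) := by
          refine GRel.pv_affine W one_ne_zero (-p) ?_
          have e : cst W 1 * (r * x.out + cst W a * (tInf W)⁻¹) + AtoFinf W (-p) -
              cst W (a₀ + a) * (tInf W)⁻¹ = r * x.out - AtoFinf W p - cst W a₀ * (tInf W)⁻¹ := by
            rw [map_one, map_neg, map_add]; ring
          rw [e]
          simpa using hp
        rw [cuspFun, hf.eq h2]
        split_ifs with ha
        · rw [ha, add_neg_cancel, map_zero, zero_mul, c_eq, Nat.cast_zero, neg_zero]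
          ring
        · rw [hf.eq (pv_zero_rel_z0 W fun h0 ↦ ha (eq_neg_of_add_eq_zero_right h0)), add_zero]
      rw [Finset.sum_congr rfl fun a _ ↦ h1 a, Finset.sum_add_distrib, Finset.sum_const,
        Finset.card_univ, nsmul_eq_mul, Finset.sum_ite_eq' Finset.univ]
      simp only [Finset.mem_univ, if_true]
      ring
    rw [integral_congr_ae (Filter.Eventually.of_forall e),
      integral_finsetSum _ fun a _ ↦ integrable_cuspFun μ hr hΛ hf _ _]
    exact Finset.sum_eq_zero fun a _ ↦ hJ _ _

lemma Phi_eq_zero_of_mem (hN : ∀ x y : k, ¬ W.toAffine.Equation x y) {f : Vert W → ℂ}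
    (hf : f ∈ spaceS W) (h0 : f (z0 W) + ∑ l : k, f (tv W l) = 0) (h1 : f (z1 W) = 0) :
    Phi W f = 0 := by
  refine congrArg Subtype.val ((evalS_bijective hN).1 (a₁ := ⟨_, Phi_mem_spaceS hN hf⟩)
    (a₂ := 0) ?_)
  rw [map_zero]
  change (Phi W f (z0 W), Phi W f (z1 W), fun l ↦ Phi W f (tv W l)) = _
  rw [Phi_z0_of_mem hf, Phi_z1, h0, h1, mul_zero]
  simp only [Phi_tv hf.1 hN, h1, mul_zero]
  rfl

/-- The cusp forms in `S`. -/
lemma isCuspForm_iff (hN : ∀ x y : k, ¬ W.toAffine.Equation x y) {f : Vert W → ℂ}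
    (hf : f ∈ spaceS W) :
    IsCuspForm W f ↔ f (z0 W) = 0 ∧ f (z1 W) = 0 ∧ ∑ l : k, f (tv W l) = 0 := by
  have hq : (Fintype.card k : ℂ) ≠ 0 := Nat.cast_ne_zero.mpr Fintype.card_ne_zero
  have hq1 : (Fintype.card k : ℂ) + 1 ≠ 0 := Nat.cast_add_one_ne_zero _
  constructor
  · intro h
    obtain ⟨hc, hc0⟩ := IsCuspForm.apply_c hN hf.1 h
    have h1 : f (z1 W) = 0 := by
      have e := hc 0
      rw [zero_add, c_one_of_mem hf] at e
      have h2 : -2 * (Fintype.card k : ℂ) ≠ 0 := mul_ne_zero (by norm_num) hq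
      exact (mul_eq_zero.mp e).resolve_left h2
    have h2 := hc 1
    rw [hf.2, cval] at h2
    simp only [coef] at h2
    rw [c_zero_of_mem hf] at hc0
    set q : ℂ := (Fintype.card k : ℂ)
    set T := ∑ l : k, f (tv W l)
    -- Eliminates T from f(c_2) = 0 and f(c_0) + (q - 1) f(z_0) = 0.
    have h3 : (q * (q + 1)) * f (z0 W) = 0 := by
      linear_combination (-1) * h2 + (q - 1) * hc0
    have hz : f (z0 W) = 0 :=
      (mul_eq_zero.mp h3).resolve_left (mul_ne_zero hq hq1)
    refine ⟨hz, h1, ?_⟩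
    linear_combination (-1 / 2) * hc0 + (q - 1) / 2 * hz
  · rintro ⟨h0, h1, hT⟩
    refine isCuspForm_of_Phi_eq_zero hN hf.1 (Phi_eq_zero_of_mem hN hf (by rw [h0, hT, add_zero]) h1)
      (fun n ↦ ?_) h0
    rw [hf.2, cval, h0, h1, hT]
    ring

end

/-! ### The curves have no affine rational points -/

section

/-- The three curves have no affine rational points. -/
lemma IsCurveX.not_equation {W : WeierstrassCurve k} (hW : IsCurveX W) (x y : k) :
    ¬ W.toAffine.Equation x y := by
  intro h
  have hpos : Nat.card k ≠ 0 := by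
    rcases hW with ⟨h, _⟩ | ⟨h, _⟩ | ⟨h, _⟩ <;> omega
  have := Nat.finite_of_card_ne_zero hpos
  have := Fintype.ofFinite k
  have hcard : ∀ a : k, a ^ Nat.card k = a := by
    intro a
    rw [Nat.card_eq_fintype_card]
    exact FiniteField.pow_card a
  have hchar : (Nat.card k : k) = 0 := by
    rw [Nat.card_eq_fintype_card]
    exact Nat.cast_card_eq_zero k
  rw [WeierstrassCurve.Affine.equation_iff'] at h
  rcases hW with ⟨hc, rfl⟩ | ⟨hc, rfl⟩ | ⟨hc, α, hα, rfl⟩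
  · rw [hc] at hcard hchar
    norm_num at hchar h
    -- Over the field with two elements y² + y and x³ + x vanish identically, so the equation reads
    -- 0 = 1.
    have e : (1 : k) = 0 := by
      linear_combination hcard y - (x + 1) * hcard x + (y - x) * hchar - h
    exact one_ne_zero e
  · rw [hc] at hcard hchar
    norm_num at hchar h
    -- Over the field with three elements x³ - x vanishes, and -1 is not a square.
    have e1 : y ^ 2 = -1 := by linear_combination h + hcard x
    have e2 : y * (y ^ 2 - 1) = 0 := by linear_combination hcard y
    rw [e1] at e2
    have hy : y = 0 := by linear_combination e2 + y * hchar
    rw [hy] at e1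
    norm_num at e1
  · rw [hc] at hcard hchar
    norm_num at hchar h
    have h2 : (2 : k) = 0 := by
      have : (2 : k) * 2 = 0 := by linear_combination hchar
      simpa using this
    -- Over the field with four elements both x³ and y² + y lie in {0, 1}, while α does not.
    have e0 : x ^ 3 * (x ^ 3 - 1) = 0 := by linear_combination x ^ 2 * hcard x
    have e1 : (y ^ 2 + y) * (y ^ 2 + y - 1) = 0 := by
      linear_combination hcard y + (y ^ 3) * h2
    have e2 : y ^ 2 + y = x ^ 3 + α := by linear_combination h
    rw [e2] at e1
    have e3 : (1 : k) = 0 := by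
      linear_combination (-1) * e1 + e0 + hα + (x ^ 3 * α - α) * h2
    exact one_ne_zero e3

end

/-! ### A basis of eigenforms -/

section

variable (W : WeierstrassCurve k)

variable [Fintype k]

variable (k) in
/-- The functions on `k` with sum zero. -/
def sumZero : Submodule ℂ (k → ℂ) := LinearMap.ker (∑ l : k, LinearMap.proj l : (k → ℂ) →ₗ[ℂ] ℂ)

lemma mem_sumZero {k : Type*} [Fintype k] {u : k → ℂ} : u ∈ sumZero k ↔ ∑ l, u l = 0 := by
  simp [sumZero, LinearMap.sum_apply]

lemma finrank_sumZero : Module.finrank ℂ (sumZero k) = Fintype.card k - 1 := by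
  classical
  have h : (∑ l : k, LinearMap.proj l : (k → ℂ) →ₗ[ℂ] ℂ) ≠ 0 := by
    intro h
    have := LinearMap.congr_fun h (Pi.single 0 1)
    simp [LinearMap.sum_apply] at this
  have := Module.Dual.finrank_ker_add_one_of_ne_zero h
  rw [Module.finrank_fintype_fun_eq_card] at this
  rw [sumZero]
  omega

/-- The values at `z_0`, `z_1` and the `t_l` of the three eigenforms that are not cusp forms,
together with the functions on the `t_l` with sum zero, decompose the space of all values. -/
def valueEquiv : (sumZero k × (Fin 3 → ℂ)) ≃ₗ[ℂ] ℂ × ℂ × (k → ℂ) where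
  toFun p := (-p.2 0 - p.2 1 + p.2 2, p.2 1 + p.2 2, fun l ↦ p.1.1 l +
    (p.2 0 + (Fintype.card k + 1) * (p.2 1 - p.2 2)) / Fintype.card k)
  map_add' p p' := by
    refine Prod.ext ?_ (Prod.ext ?_ (funext fun l ↦ ?_)) <;> simp <;> ring
  map_smul' a p := by
    refine Prod.ext ?_ (Prod.ext ?_ (funext fun l ↦ ?_)) <;> simp <;> ring
  -- For the coefficients c₀, c₁, c₂ of the three eigenforms, z_0 + T = q (c₁ - c₂), z_1 = c₁ + c₂
  -- and z_0 = -c₀ - (c₁ - c₂); the inverse solves these equations.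
  invFun p := (⟨fun l ↦ p.2.2 l - (∑ l, p.2.2 l) / Fintype.card k, by
      rw [mem_sumZero, Finset.sum_sub_distrib, Finset.sum_const, Finset.card_univ, nsmul_eq_mul,
        mul_div_cancel₀ _ (Nat.cast_ne_zero.mpr Fintype.card_ne_zero), sub_self]⟩,
    ![-p.1 - (p.1 + ∑ l, p.2.2 l) / Fintype.card k,
      (p.2.1 + (p.1 + ∑ l, p.2.2 l) / Fintype.card k) / 2,
      (p.2.1 - (p.1 + ∑ l, p.2.2 l) / Fintype.card k) / 2])
  left_inv p := by
    obtain ⟨⟨u, hu⟩, c⟩ := p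
    have hq : (Fintype.card k : ℂ) ≠ 0 := Nat.cast_ne_zero.mpr Fintype.card_ne_zero
    rw [mem_sumZero] at hu
    have hT : ∑ l, (u l + (c 0 + (Fintype.card k + 1) * (c 1 - c 2)) / Fintype.card k) =
        c 0 + (Fintype.card k + 1) * (c 1 - c 2) := by
      rw [Finset.sum_add_distrib, hu, Finset.sum_const, Finset.card_univ, nsmul_eq_mul,
        mul_div_cancel₀ _ hq, zero_add]
    refine Prod.ext (Subtype.ext (funext fun l ↦ ?_)) (funext fun j ↦ ?_)
    · simp only [hT]
      ring
    · simp only [hT]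
      fin_cases j <;> simp <;> field_simp <;> ring
  right_inv p := by
    obtain ⟨a, b, u⟩ := p
    have hq : (Fintype.card k : ℂ) ≠ 0 := Nat.cast_ne_zero.mpr Fintype.card_ne_zero
    refine Prod.ext ?_ (Prod.ext ?_ (funext fun l ↦ ?_))
    · simp
      ring
    · simp
      ring
    · simp
      field_simp
      ring

variable {W}

/-- The parametrization of the space `S` by the values of its elements. -/
def equivS (hN : ∀ x y : k, ¬ W.toAffine.Equation x y) :
    (sumZero k × (Fin 3 → ℂ)) ≃ₗ[ℂ] spaceS W :=
  valueEquiv.trans (LinearEquiv.ofBijective (evalS W) (evalS_bijective hN)).symm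

lemma evalS_equivS (hN : ∀ x y : k, ¬ W.toAffine.Equation x y) (p : sumZero k × (Fin 3 → ℂ)) :
    evalS W (equivS hN p) = valueEquiv p :=
  (LinearEquiv.ofBijective (evalS W) (evalS_bijective hN)).apply_symm_apply _

lemma equivS_z0 (hN : ∀ x y : k, ¬ W.toAffine.Equation x y) (p : sumZero k × (Fin 3 → ℂ)) :
    (equivS hN p : Vert W → ℂ) (z0 W) = -p.2 0 - p.2 1 + p.2 2 :=
  congrArg Prod.fst (evalS_equivS hN p)

lemma equivS_z1 (hN : ∀ x y : k, ¬ W.toAffine.Equation x y) (p : sumZero k × (Fin 3 → ℂ)) :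
    (equivS hN p : Vert W → ℂ) (z1 W) = p.2 1 + p.2 2 :=
  congrArg (fun a ↦ a.2.1) (evalS_equivS hN p)

lemma equivS_tv (hN : ∀ x y : k, ¬ W.toAffine.Equation x y) (p : sumZero k × (Fin 3 → ℂ)) (l : k) :
    (equivS hN p : Vert W → ℂ) (tv W l) = p.1.1 l +
      (p.2 0 + (Fintype.card k + 1) * (p.2 1 - p.2 2)) / Fintype.card k :=
  congrFun (congrArg (fun a ↦ a.2.2) (evalS_equivS hN p)) l

lemma sum_equivS_tv (hN : ∀ x y : k, ¬ W.toAffine.Equation x y) (p : sumZero k × (Fin 3 → ℂ)) :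
    ∑ l : k, (equivS hN p : Vert W → ℂ) (tv W l) =
      p.2 0 + (Fintype.card k + 1) * (p.2 1 - p.2 2) := by
  have hq : (Fintype.card k : ℂ) ≠ 0 := Nat.cast_ne_zero.mpr Fintype.card_ne_zero
  simp only [equivS_tv]
  rw [Finset.sum_add_distrib, mem_sumZero.mp p.1.2, Finset.sum_const, Finset.card_univ,
    nsmul_eq_mul, mul_div_cancel₀ _ hq, zero_add]

lemma isCuspForm_equivS_iff (hN : ∀ x y : k, ¬ W.toAffine.Equation x y)
    (p : sumZero k × (Fin 3 → ℂ)) : IsCuspForm W (equivS hN p : Vert W → ℂ) ↔ p.2 = 0 := by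
  rw [isCuspForm_iff hN (equivS hN p).2, equivS_z0, equivS_z1, sum_equivS_tv]
  constructor
  · rintro ⟨h0, h1, h2⟩
    have hq : (Fintype.card k : ℂ) ≠ 0 := Nat.cast_ne_zero.mpr Fintype.card_ne_zero
    have h3 : p.2 1 - p.2 2 = 0 :=
      (mul_eq_zero.mp (by linear_combination h0 + h2 :
        (Fintype.card k : ℂ) * (p.2 1 - p.2 2) = 0)).resolve_left hq
    funext j
    fin_cases j
    · change p.2 0 = 0
      linear_combination -h0 - h3
    · change p.2 1 = 0
      linear_combination (h1 + h3) / 2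
    · change p.2 2 = 0
      linear_combination (h1 - h3) / 2
  · intro h
    simp [h]

/-- The coordinates diagonalize Φ: the sum-zero part and the first coefficient span the kernel, and
the other two coefficients belong to q and -q. It suffices to compare values at z_0, z_1 and the
t_l. -/
lemma Phi_equivS (hN : ∀ x y : k, ¬ W.toAffine.Equation x y) (p : sumZero k × (Fin 3 → ℂ)) :
    Phi W (equivS hN p : Vert W → ℂ) =
      (equivS hN (0, ![0, Fintype.card k * p.2 1, -Fintype.card k * p.2 2]) : Vert W → ℂ) := by
  have hq : (Fintype.card k : ℂ) ≠ 0 := Nat.cast_ne_zero.mpr Fintype.card_ne_zero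
  refine congrArg Subtype.val ((evalS_bijective hN).1
    (a₁ := ⟨_, Phi_mem_spaceS hN (equivS hN p).2⟩) (a₂ := equivS hN _) ?_)
  refine Prod.ext ?_ (Prod.ext ?_ (funext fun l ↦ ?_))
  · change Phi W _ (z0 W) = (equivS hN _ : Vert W → ℂ) (z0 W)
    rw [Phi_z0_of_mem (equivS hN p).2, equivS_z1, equivS_z0]
    simp
    ring
  · change Phi W _ (z1 W) = (equivS hN _ : Vert W → ℂ) (z1 W)
    rw [Phi_z1, sum_equivS_tv, equivS_z1, equivS_z0]
    simp
    ring
  · change Phi W _ (tv W l) = (equivS hN _ : Vert W → ℂ) (tv W l)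
    rw [Phi_tv (equivS hN p).2.1 hN, equivS_z1, equivS_tv]
    simp
    field_simp

lemma supportedOnT_of_isCuspForm (hN : ∀ x y : k, ¬ W.toAffine.Equation x y) {f : Vert W → ℂ}
    (hf : f ∈ spaceS W) (h : IsCuspForm W f) : SupportedOnT W f := by
  obtain ⟨h0, h1, hT⟩ := (isCuspForm_iff hN hf).mp h
  intro v hv
  obtain ⟨i, hi⟩ := exists_rep hN v
  rw [hf.1.eq hi] at hv
  cases i with
  | c n =>
    refine absurd ?_ hv
    change f (c W n) = 0
    rw [hf.2, cval, h0, h1, hT]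
    ring
  | z0 => exact absurd h0 hv
  | z1 => exact absurd h1 hv
  | t l =>
    obtain ⟨γ, hγ⟩ := hi.symm
    exact ⟨l, _, ⟨γ, rfl⟩, hγ.symm⟩

/-- A basis of eigenforms of the space `S`. -/
def basisS (hN : ∀ x y : k, ¬ W.toAffine.Equation x y) :
    Module.Basis (Fin (Fintype.card k - 1) ⊕ Fin 3) ℂ (spaceS W) :=
  ((Module.finBasisOfFinrankEq ℂ (sumZero k) finrank_sumZero).prod (Pi.basisFun ℂ (Fin 3))).map
    (equivS hN)

lemma basisS_inl (hN : ∀ x y : k, ¬ W.toAffine.Equation x y) (i : Fin (Fintype.card k - 1)) :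
    basisS hN (.inl i) =
      equivS hN (Module.finBasisOfFinrankEq ℂ (sumZero k) finrank_sumZero i, 0) := by
  rw [basisS, Module.Basis.map_apply, Module.Basis.prod_apply]
  rfl

lemma basisS_inr (hN : ∀ x y : k, ¬ W.toAffine.Equation x y) (j : Fin 3) :
    basisS hN (.inr j) = equivS hN (0, Pi.single j 1) := by
  rw [basisS, Module.Basis.map_apply, Module.Basis.prod_apply]
  simp

lemma isCuspForm_iff_mem_span (hN : ∀ x y : k, ¬ W.toAffine.Equation x y) (f : spaceS W) :
    IsCuspForm W (f : Vert W → ℂ) ↔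
      f ∈ Submodule.span ℂ (Set.range fun i ↦ basisS hN (.inl i)) := by
  have h : Submodule.span ℂ (Set.range fun i ↦ basisS hN (.inl i)) =
      LinearMap.range ((equivS hN).toLinearMap ∘ₗ LinearMap.inl ℂ (sumZero k) (Fin 3 → ℂ)) := by
    rw [LinearMap.range_eq_map,
      ← (Module.finBasisOfFinrankEq ℂ (sumZero k) finrank_sumZero).span_eq, Submodule.map_span,
      ← Set.range_comp]
    congr 2
    funext i
    rw [basisS_inl]
    rfl
  obtain ⟨p, rfl⟩ := (equivS hN).surjective f
  rw [h, isCuspForm_equivS_iff]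
  constructor
  · intro hp
    exact ⟨p.1, congrArg (equivS hN) (Prod.ext rfl hp.symm)⟩
  · rintro ⟨u, hu⟩
    rw [← (equivS hN).injective hu]
    rfl

end

end EllTree

end

theorem mainTheorem5 {k : Type*} [Field k] [Fintype k] (W : WeierstrassCurve k)
    (hW : EllTree.IsCurveX W) :
    (∃! S : Submodule ℂ (EllTree.Vert W → ℂ), EllTree.IsSpaceS W S) ∧
    ∀ S : Submodule ℂ (EllTree.Vert W → ℂ), EllTree.IsSpaceS W S →
      ∃ b : Module.Basis (Fin (Fintype.card k - 1) ⊕ Fin 3) ℂ S,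
        (∀ i : Fin (Fintype.card k - 1),
          EllTree.Phi W (b (Sum.inl i) : EllTree.Vert W → ℂ) = 0 ∧
          EllTree.IsCuspForm W (b (Sum.inl i) : EllTree.Vert W → ℂ) ∧
          EllTree.SupportedOnT W (b (Sum.inl i) : EllTree.Vert W → ℂ)) ∧
        (∀ j : Fin 3,
          EllTree.Phi W (b (Sum.inr j) : EllTree.Vert W → ℂ) =
            (![0, (Fintype.card k : ℂ), -(Fintype.card k : ℂ)] j) •
              (b (Sum.inr j) : EllTree.Vert W → ℂ) ∧
          ¬ EllTree.IsCuspForm W (b (Sum.inr j) : EllTree.Vert W → ℂ)) ∧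
        (∀ f : S, EllTree.IsCuspForm W (f : EllTree.Vert W → ℂ) ↔
          f ∈ Submodule.span ℂ (Set.range fun i : Fin (Fintype.card k - 1) => b (Sum.inl i))) := by
  have hN := hW.not_equation
  refine ⟨⟨_, EllTree.isSpaceS_spaceS hN, fun S hS ↦ EllTree.eq_spaceS hN hS⟩, fun S hS ↦ ?_⟩
  obtain rfl := EllTree.eq_spaceS hN hS
  refine ⟨EllTree.basisS hN, fun i ↦ ?_, fun j ↦ ?_, EllTree.isCuspForm_iff_mem_span hN⟩
  · have h : EllTree.IsCuspForm W (EllTree.basisS hN (.inl i) : EllTree.Vert W → ℂ) := by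
      rw [EllTree.basisS_inl, EllTree.isCuspForm_equivS_iff]
    refine ⟨?_, h, EllTree.supportedOnT_of_isCuspForm hN (Subtype.prop _) h⟩
    obtain ⟨h0, h1, hT⟩ := (EllTree.isCuspForm_iff hN (Subtype.prop _)).mp h
    exact EllTree.Phi_eq_zero_of_mem hN (Subtype.prop _) (by rw [h0, hT, add_zero]) h1
  · rw [EllTree.basisS_inr, EllTree.isCuspForm_equivS_iff, EllTree.Phi_equivS, ← Submodule.coe_smul,
      ← map_smul]
    constructor
    · refine congrArg (fun p ↦ (EllTree.equivS hN p : EllTree.Vert W → ℂ))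
        (Prod.ext (smul_zero _).symm (funext fun i ↦ ?_))
      fin_cases j <;> fin_cases i <;> simp
    · simp
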